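/- Let $\delta \ge 0$ and let $P=\{p_1,\dots,p_n\}$ be a set of $n$ distinct points (terminals) in the strip $\mathbb{R}\times[0,\delta]$, with $p_l=(x_l,y_l)$ and $x_1\le x_2\le\dots\le x_n$. A rectilinear tree is a finite tree embedded in the plane whose edges are horizontal or vertical segments that overlap only at their endpoints; its length is the sum of the lengths of its edges. A rectilinear Steiner tree for $P$ is a rectilinear tree such that every terminal is an endpoint of an edge; an MRST on $P$ is such a tree of minimum length. A full component of a rectilinear Steiner tree is a maximal subtree (with at least one edge) in which no terminal is an internal node. A complete segment is a maximal sequence of adjacent collinear edges with no terminal in its interior; a corner is a non-terminal point of degree 2 whose incident edges are not collinear, and the two complete segments ending there are its legs. A Hwang tree on $P$ is an MRST $T$ on $P$ that has the maximum number of full components among all MRSTs on $P$ and in which every full component $C$, with $m_C$ terminals (which are exactly its leaves), consists of 1. four edges, connected in a cross; or 2. a single complete segment with $m_C-2$ incident edges, alternating between its two sides; or 3. a corner and its legs, with $m_C-2$ alternating edges incident to a single leg; or 4. a corner and its legs, with $m_C-3$ alternating edges incident to a single leg and a single edge incident to the other leg; where, in 3 and 4, for each leg that has incident edges the one closest to the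 corner points away from the opposite leg, and the edges incident to the long leg (the leg with the $m_C-2$, respectively $m_C-3$, incident edges) on the same side as the other (short) leg are at least as long as the short leg. Let $T$ be a Hwang tree on $P$. Let $c_1\ge 0$ be an integer, $c_2>0$ a real number, and let $i$ be such that $1\le i<n$, $x_i<x_{i+1}$, $i+\lceil\sqrt\delta\rceil+c_1\le n$ and $$x_{i+\lceil\sqrt\delta\rceil+c_1}-x_i>c_2\sqrt\delta .$$ Let $s_i$ be the vertical line with $x$-coordinate $(x_i+x_{i+1})/2$. Then $T$ crosses $s_i$ (that is, meets $s_i$ in a number of points that is) at most $$17c_1+36+\left(\frac{4}{c_2}+17\right)\sqrt\delta$$ times; in particular $O(\sqrt\delta+1)$ times for fixed $c_1,c_2$. -/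

import Mathlib

namespace Rectilinear

/-- Points of the plane. -/
abbrev Pt : Type := ℝ × ℝ

/-- The length of the edge between `a` and `b`. It is only used for horizontal and vertical edges,
for which it is the usual length. -/
noncomputable def edgeLength : Sym2 Pt → ℝ :=
  Sym2.lift ⟨fun a b => |a.1 - b.1| + |a.2 - b.2|, fun a b => by
    simp only [abs_sub_comm a.1, abs_sub_comm a.2]⟩

/-- The closed line segment covered by an edge. -/
def edgeSegment : Sym2 Pt → Set Pt :=
  Sym2.lift ⟨fun a b => segment ℝ a b, fun a b => segment_symm ℝ a b⟩

/-- A rectilinear tree: a (finite, nonempty) tree embedded in the plane whose edges are horizontal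
or vertical line segments overlapping only at their common endpoints. It is given by its edges, as
a graph on the points of the plane; the nodes of the tree are the endpoints of its edges, that is,
the support of the graph. -/
structure RectTree where
  graph : SimpleGraph Pt
  finite_edges : graph.edgeSet.Finite
  nonempty : graph.edgeSet.Nonempty
  acyclic : graph.IsAcyclic
  connected : ∀ a ∈ graph.support, ∀ b ∈ graph.support, graph.Reachable a b
  axis_parallel : ∀ a b, graph.Adj a b → a.1 = b.1 ∨ a.2 = b.2
  embedded : ∀ e ∈ graph.edgeSet, ∀ e' ∈ graph.edgeSet, e ≠ e' →
    ∀ q, q ∈ edgeSegment e → q ∈ edgeSegment e' → q ∈ e ∧ q ∈ e'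

namespace RectTree

/-- The length of a tree: the sum of the lengths of its edges. -/
noncomputable def length (T : RectTree) : ℝ :=
  ∑ e ∈ T.finite_edges.toFinset, edgeLength e

/-- The part of the plane covered by the edges of the tree. -/
def pointSet (T : RectTree) : Set Pt :=
  {q | ∃ e ∈ T.graph.edgeSet, q ∈ edgeSegment e}

/-- The points where `T` meets the vertical line with `x`-coordinate `s`. The tonicity of `T` at
that line is the number of these points. -/
def crossings (T : RectTree) (s : ℝ) : Set Pt :=
  {q | q ∈ T.pointSet ∧ q.1 = s}

end RectTree

/-- `T` is a rectilinear Steiner tree for the terminal set `P`: every terminal is an endpoint of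
an edge. -/
def IsSteinerTree (P : Set Pt) (T : RectTree) : Prop :=
  P ⊆ T.graph.support

/-- `T` is a minimum rectilinear Steiner tree (MRST) on `P`. -/
def IsMRST (P : Set Pt) (T : RectTree) : Prop :=
  IsSteinerTree P T ∧ ∀ T' : RectTree, IsSteinerTree P T' → T.length ≤ T'.length

/-- The subgraph `C` of the tree `T` is a subtree with at least one edge in which no terminal is
an internal node, that is, in which every terminal has degree at most one. (A connected subgraph
of a tree is a tree.) -/
def IsTerminalFreeSubtree (P : Set Pt) (T : RectTree) (C : T.graph.Subgraph) : Prop :=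
  C.Connected ∧ C.edgeSet.Nonempty ∧ ∀ p ∈ P, (C.neighborSet p).Subsingleton

/-- Full components: maximal subtrees that do not have terminals as internal nodes. -/
def IsFullComponent (P : Set Pt) (T : RectTree) (C : T.graph.Subgraph) : Prop :=
  Maximal (IsTerminalFreeSubtree P T) C

/-- The number of full components of `T`. -/
noncomputable def numFullComponents (P : Set Pt) (T : RectTree) : ℕ :=
  {C : T.graph.Subgraph | IsFullComponent P T C}.ncard

/-- `u` and `w` are two perpendicular directions, one horizontal and one vertical. -/
def IsAxisFrame (u w : Pt) : Prop :=
  ((u = (1, 0) ∨ u = (-1, 0)) ∧ (w = (0, 1) ∨ w = (0, -1))) ∨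
  ((u = (0, 1) ∨ u = (0, -1)) ∧ (w = (1, 0) ∨ w = (-1, 0)))

/-- The edges of a complete segment that leaves `z` in direction `u`, together with its `k`
incident edges. The segment has the nodes `z + t 0 • u, …, z + t (k + 1) • u`; the `j`-th incident
edge, for `1 ≤ j ≤ k`, joins the `j`-th of them to `z + t j • u + h j • w`. -/
def combEdges (z u w : Pt) (k : ℕ) (t h : ℕ → ℝ) : Set (Sym2 Pt) :=
  {e | ∃ j, j ≤ k ∧ e = s(z + t j • u, z + t (j + 1) • u)} ∪
  {e | ∃ j, 1 ≤ j ∧ j ≤ k ∧ e = s(z + t j • u, z + t j • u + h j • w)}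

/-- The data of `combEdges` describe a segment that starts in `z`, whose incident edges alternate
between the two sides, the one closest to `z` pointing in direction `-w`. The other endpoint of
the segment and the outer endpoints of the incident edges are terminals. -/
structure IsAlternatingComb (P : Set Pt) (z u w : Pt) (k : ℕ) (t h : ℕ → ℝ) : Prop where
  start : t 0 = 0
  increasing : ∀ j, j ≤ k → t j < t (j + 1)
  alternating : ∀ j, 1 ≤ j → j ≤ k → 0 < (-1 : ℝ) ^ j * h j
  end_terminal : z + t (k + 1) • u ∈ P
  tip_terminal : ∀ j, 1 ≤ j → j ≤ k → z + t j • u + h j • w ∈ P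

/-- Four edges, connected in a cross. In this and in the next three definitions `E` is the edge
set of a full component. The leaves are terminals (and the internal nodes are not, the component
being full), so that the numbers of incident edges below are those expressed through the number
`m` of terminals in the component. -/
def IsCross (P : Set Pt) (E : Set (Sym2 Pt)) : Prop :=
  ∃ (z : Pt) (a b c d : ℝ), 0 < a ∧ 0 < b ∧ 0 < c ∧ 0 < d ∧
    z + (a, 0) ∈ P ∧ z + (-b, 0) ∈ P ∧ z + (0, c) ∈ P ∧ z + (0, -d) ∈ P ∧
    E = {s(z, z + (a, 0)), s(z, z + (-b, 0)), s(z, z + (0, c)), s(z, z + (0, -d))}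

/-- A single complete segment with `m - 2 = k` alternating incident edges. Since `w` and `-w` are
both allowed, the first incident edge may lie on either side. -/
def IsSegmentType (P : Set Pt) (E : Set (Sym2 Pt)) : Prop :=
  ∃ (z u w : Pt) (k : ℕ) (t h : ℕ → ℝ), IsAxisFrame u w ∧ IsAlternatingComb P z u w k t h ∧
    z ∈ P ∧ E = combEdges z u w k t h

/-- A corner `z` and its legs, with `m - 2 = k` alternating edges incident to a single leg (the
long leg, in direction `u`). The other leg has direction `w` and length `b`. The incident edge
closest to the corner points away from the other leg, and the edges on the side of the
short leg (those with even index) are at least as long as the short leg. -/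
def IsCornerType (P : Set Pt) (E : Set (Sym2 Pt)) : Prop :=
  ∃ (z u w : Pt) (k : ℕ) (t h : ℕ → ℝ) (b : ℝ), IsAxisFrame u w ∧
    IsAlternatingComb P z u w k t h ∧ 0 < b ∧ z + b • w ∈ P ∧
    (∀ j, 1 ≤ j → j ≤ k → 0 < h j → b ≤ h j) ∧
    E = combEdges z u w k t h ∪ {s(z, z + b • w)}

/-- A corner `z` and its legs, with `m - 3 = k` alternating edges incident to the long leg, as in
`IsCornerType`, and a single edge incident to the other leg, at distance `r` from the corner. This
edge, of length `q`, points away from the long leg. -/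
def IsCornerTypeWithEdge (P : Set Pt) (E : Set (Sym2 Pt)) : Prop :=
  ∃ (z u w : Pt) (k : ℕ) (t h : ℕ → ℝ) (b r q : ℝ), IsAxisFrame u w ∧
    IsAlternatingComb P z u w k t h ∧ 0 < r ∧ r < b ∧ 0 < q ∧
    z + b • w ∈ P ∧ z + r • w - q • u ∈ P ∧
    (∀ j, 1 ≤ j → j ≤ k → 0 < h j → b ≤ h j) ∧
    E = combEdges z u w k t h ∪
      {s(z, z + r • w), s(z + r • w, z + b • w), s(z + r • w, z + r • w - q • u)}

/-- Hwang trees: MRSTs with the maximum number of full components among all MRSTs on `P`, in which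
every full component is of one of the four types. -/
def IsHwangTree (P : Set Pt) (T : RectTree) : Prop :=
  IsMRST P T ∧
  (∀ T' : RectTree, IsMRST P T' → numFullComponents P T' ≤ numFullComponents P T) ∧
  ∀ C : T.graph.Subgraph, IsFullComponent P T C →
    IsCross P C.edgeSet ∨ IsSegmentType P C.edgeSet ∨ IsCornerType P C.edgeSet ∨
      IsCornerTypeWithEdge P C.edgeSet

end Rectilinear

namespace Rectilinear

/-! ### Segments and edge lengths -/

/-! Let `a = s_i`, let `b` be the `x`-coordinate of the terminal with index `i + ⌈√δ⌉ + c₁`, and let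
`W` be the set of terminals strictly between these vertical lines. Two estimates for the horizontal
length of `T` in the strip are played against each other.

Upper estimate (`sum_windowLength_le`): discard everything that `T` has strictly between the two
lines, and reconnect by the two vertical segments of height `δ`, one horizontal segment of length `b
- a`, and a horizontal segment from the line at `a` to each terminal of `W`. By minimality of `T`,
the discarded horizontal length is at most `2δ + (|W| + 1)(b - a)`. The reconnected figure need not
be a tree, but it contains a Steiner tree that is no longer (`exists_steinerTree_of_linked`).

Lower estimate (`ncard_cut_le`, `mul_le_sum_windowLength`): the four shapes of full components share
a few local properties (`IsLocallyAlternating`). Suppose that at a non-terminal node a horizontal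
edge coming from the left is not continued to the right. If an edge goes up, its upper end is a
terminal or, by alternation, the start of a new edge to the right. If none goes up, then an edge
goes down, and it leads straight down to a terminal. So the number of horizontal edges drops by at
most three per terminal passed, and it stays at least `N - 3|W|` over the strip, where `N` is the
number at `a`. Integration gives the horizontal length at least `(N - 3|W|)(b - a)`.

Together, `N ≤ 2δ / (b - a) + 4|W| + 1`. Here `|W| < ⌈√δ⌉ + c₁`, and `b - a` is at least half of the
assumed gap. Since every node is vertically aligned with a terminal and `s_i` avoids the terminals,
all crossings with `s_i` come from these `N` edges. -/

theorem mem_segment_of_snd_eq {a b q : Pt} (h : a.2 = b.2) :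
    q ∈ segment ℝ a b ↔ q.2 = a.2 ∧ q.1 ∈ Set.uIcc a.1 b.1 := by
  obtain ⟨x, y⟩ := a
  obtain ⟨x', y'⟩ := b
  obtain ⟨u, v⟩ := q
  simp only at h
  subst h
  rw [← Prod.image_mk_segment_left, segment_eq_uIcc]
  simp only [Set.mem_image, Prod.mk.injEq]
  constructor
  · rintro ⟨c, hc, rfl, rfl⟩
    exact ⟨rfl, hc⟩
  · rintro ⟨rfl, hc⟩
    exact ⟨u, hc, rfl, rfl⟩

theorem mem_segment_of_fst_eq {a b q : Pt} (h : a.1 = b.1) :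
    q ∈ segment ℝ a b ↔ q.1 = a.1 ∧ q.2 ∈ Set.uIcc a.2 b.2 := by
  obtain ⟨x, y⟩ := a
  obtain ⟨x', y'⟩ := b
  obtain ⟨u, v⟩ := q
  simp only at h
  subst h
  rw [← Prod.image_mk_segment_right, segment_eq_uIcc]
  simp only [Set.mem_image, Prod.mk.injEq]
  constructor
  · rintro ⟨c, hc, rfl, rfl⟩
    exact ⟨rfl, hc⟩
  · rintro ⟨rfl, hc⟩
    exact ⟨v, hc, rfl, rfl⟩

theorem mem_segment_horizontal {x x' y : ℝ} {q : Pt} :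
    q ∈ segment ℝ (x, y) (x', y) ↔ q.2 = y ∧ q.1 ∈ Set.uIcc x x' :=
  mem_segment_of_snd_eq (a := (x, y)) (b := (x', y)) rfl

theorem mem_segment_vertical {x y y' : ℝ} {q : Pt} :
    q ∈ segment ℝ (x, y) (x, y') ↔ q.1 = x ∧ q.2 ∈ Set.uIcc y y' :=
  mem_segment_of_fst_eq (a := (x, y)) (b := (x, y')) rfl

@[simp] theorem edgeLength_mk (a b : Pt) : edgeLength s(a, b) = |a.1 - b.1| + |a.2 - b.2| := rfl

@[simp] theorem edgeSegment_mk (a b : Pt) : edgeSegment s(a, b) = segment ℝ a b := rfl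

theorem edgeLength_nonneg (e : Sym2 Pt) : 0 ≤ edgeLength e := by
  induction e with
  | _ a b => rw [edgeLength_mk]; positivity

/-! ### Trees inside a union of segments -/

/-- `x < x'` are consecutive elements of `X`. -/
def Consecutive (X : Finset ℝ) (x x' : ℝ) : Prop :=
  x ∈ X ∧ x' ∈ X ∧ x < x' ∧ ∀ c ∈ X, c ≤ x ∨ x' ≤ c

/-- The edges of the grid with coordinates in `X` and `Y`. -/
def IsGridEdge (X Y : Finset ℝ) (e : Sym2 Pt) : Prop :=
  (∃ x x' y, Consecutive X x x' ∧ y ∈ Y ∧ e = s((x, y), (x', y))) ∨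
  (∃ x y y', Consecutive Y y y' ∧ x ∈ X ∧ e = s((x, y), (x, y')))

/-- Split at any grid coordinate strictly between the ends, by induction on how many there are. The
parameter `f` is an isometric axis-parallel line, so that one induction serves both directions. The
length is only bounded above, so that unions of edge sets need no disjointness. -/
theorem exists_subdivision {f : ℝ → Pt} (hf : ∀ x x', edgeLength s(f x, f x') = |x - x'|)
    (X : Finset ℝ) (x x' : ℝ) (hx : x ∈ X) (hx' : x' ∈ X) (hle : x ≤ x') :
    ∃ S : Finset (Sym2 Pt), (∀ e ∈ S, ∃ c c', Consecutive X c c' ∧ e = s(f c, f c')) ∧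
      ∑ e ∈ S, edgeLength e ≤ x' - x ∧
      ∀ c ∈ X, x ≤ c → c ≤ x' →
        (SimpleGraph.fromEdgeSet (S : Set (Sym2 Pt))).Reachable (f x) (f c) := by
  classical
  induction hn : (X.filter fun c => x < c ∧ c < x').card using Nat.strong_induction_on
    generalizing x x' with
  | _ n ih =>
    rcases hle.eq_or_lt with rfl | hlt
    · refine ⟨∅, by simp, by simp, fun c _ h1 h2 => ?_⟩
      rw [le_antisymm h2 h1]
    by_cases hc : ∃ c ∈ X, x < c ∧ c < x'
    · obtain ⟨c, hcX, h1, h2⟩ := hc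
      have hlt1 : (X.filter fun d => x < d ∧ d < c).card < n := by
        rw [← hn]
        refine Finset.card_lt_card ((Finset.ssubset_iff_of_subset ?_).2 ⟨c, ?_, ?_⟩)
        · intro d
          simp only [Finset.mem_filter]
          exact fun h => ⟨h.1, h.2.1, h.2.2.trans h2⟩
        · simp [hcX, h1, h2]
        · simp
      have hlt2 : (X.filter fun d => c < d ∧ d < x').card < n := by
        rw [← hn]
        refine Finset.card_lt_card ((Finset.ssubset_iff_of_subset ?_).2 ⟨c, ?_, ?_⟩)
        · intro d
          simp only [Finset.mem_filter]
          exact fun h => ⟨h.1, h1.trans h.2.1, h.2.2⟩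
        · simp [hcX, h1, h2]
        · simp
      obtain ⟨S, hS, hS', hS''⟩ := ih _ hlt1 x c hx hcX h1.le rfl
      obtain ⟨U, hU, hU', hU''⟩ := ih _ hlt2 c x' hcX hx' h2.le rfl
      have hmono1 : SimpleGraph.fromEdgeSet (S : Set (Sym2 Pt)) ≤
          SimpleGraph.fromEdgeSet ((S ∪ U : Finset (Sym2 Pt)) : Set (Sym2 Pt)) :=
        SimpleGraph.fromEdgeSet_mono (by simp)
      have hmono2 : SimpleGraph.fromEdgeSet (U : Set (Sym2 Pt)) ≤
          SimpleGraph.fromEdgeSet ((S ∪ U : Finset (Sym2 Pt)) : Set (Sym2 Pt)) :=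
        SimpleGraph.fromEdgeSet_mono (by simp)
      refine ⟨S ∪ U, ?_, ?_, ?_⟩
      · intro e he
        rcases Finset.mem_union.1 he with he | he
        exacts [hS e he, hU e he]
      · have h := Finset.sum_union_inter (s₁ := S) (s₂ := U) (f := edgeLength)
        have h' : 0 ≤ ∑ e ∈ S ∩ U, edgeLength e :=
          Finset.sum_nonneg fun e _ => edgeLength_nonneg e
        linarith
      · intro d hd hd1 hd2
        rcases le_total d c with h | h
        · exact (hS'' d hd hd1 h).mono hmono1
        · exact ((hS'' c hcX h1.le le_rfl).mono hmono1).trans ((hU'' d hd h hd2).mono hmono2)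
    · push Not at hc
      refine ⟨{s(f x, f x')}, ?_, ?_, ?_⟩
      · intro e he
        refine ⟨x, x', ⟨hx, hx', hlt, fun c hcX => ?_⟩, by simpa using he⟩
        rcases le_or_gt c x with h | h
        exacts [Or.inl h, Or.inr (hc c hcX h)]
      · rw [Finset.sum_singleton, hf, abs_sub_comm, abs_of_pos (by linarith)]
      · intro c hcX h1 h2
        rcases h1.eq_or_lt with rfl | h1
        · exact SimpleGraph.Reachable.rfl
        · rw [le_antisymm h2 (hc c hcX h1)]
          refine SimpleGraph.Adj.reachable ?_
          rw [SimpleGraph.fromEdgeSet_adj]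
          refine ⟨by simp, fun h => ?_⟩
          have := hf x x'
          rw [h, edgeLength_mk] at this
          simp only [sub_self, abs_zero, add_zero] at this
          rw [eq_comm, abs_eq_zero] at this
          linarith

theorem exists_subdivision_segment (X Y : Finset ℝ) (a b : Pt) (ha : a.1 ∈ X ∧ a.2 ∈ Y)
    (hb : b.1 ∈ X ∧ b.2 ∈ Y) (hab : a.1 = b.1 ∨ a.2 = b.2) :
    ∃ S : Finset (Sym2 Pt), (∀ e ∈ S, IsGridEdge X Y e) ∧
      ∑ e ∈ S, edgeLength e ≤ edgeLength s(a, b) ∧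
      ∀ q q' : Pt, q ∈ segment ℝ a b → q' ∈ segment ℝ a b → q.1 ∈ X → q.2 ∈ Y → q'.1 ∈ X →
        q'.2 ∈ Y → (SimpleGraph.fromEdgeSet (S : Set (Sym2 Pt))).Reachable q q' := by
  rcases hab with h | h
  · obtain ⟨S, h1, h2, h3⟩ := exists_subdivision (f := fun y => (a.1, y)) (by simp) Y
      (a.2 ⊓ b.2) (a.2 ⊔ b.2) (by rcases min_choice a.2 b.2 with h | h <;> rw [h]; exacts [ha.2, hb.2])
      (by rcases max_choice a.2 b.2 with h | h <;> rw [h]; exacts [ha.2, hb.2]) inf_le_sup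
    refine ⟨S, fun e he => ?_, ?_, ?_⟩
    · obtain ⟨c, c', hc, rfl⟩ := h1 e he
      exact Or.inr ⟨a.1, c, c', hc, ha.1, rfl⟩
    · refine h2.trans ?_
      rw [edgeLength_mk, h, sub_self, abs_zero, zero_add, max_sub_min_eq_abs, abs_sub_comm]
    · intro q q' hq hq' _ hq2 _ hq2'
      rw [mem_segment_of_fst_eq h] at hq hq'
      have r := h3 q.2 hq2 hq.2.1 hq.2.2
      have r' := h3 q'.2 hq2' hq'.2.1 hq'.2.2
      rw [← hq.1] at r
      rw [← hq'.1] at r'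
      have e : ((q.1, a.2 ⊓ b.2) : Pt) = (q'.1, a.2 ⊓ b.2) := by rw [hq.1, hq'.1]
      rw [e] at r
      exact r.symm.trans r'
  · obtain ⟨S, h1, h2, h3⟩ := exists_subdivision (f := fun x => (x, a.2)) (by simp) X
      (a.1 ⊓ b.1) (a.1 ⊔ b.1) (by rcases min_choice a.1 b.1 with h | h <;> rw [h]; exacts [ha.1, hb.1])
      (by rcases max_choice a.1 b.1 with h | h <;> rw [h]; exacts [ha.1, hb.1]) inf_le_sup
    refine ⟨S, fun e he => ?_, ?_, ?_⟩
    · obtain ⟨c, c', hc, rfl⟩ := h1 e he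
      exact Or.inl ⟨c, c', a.2, hc, ha.2, rfl⟩
    · refine h2.trans ?_
      rw [edgeLength_mk, h, sub_self, abs_zero, add_zero, max_sub_min_eq_abs, abs_sub_comm]
    · intro q q' hq hq' hq1 _ hq1' _
      rw [mem_segment_of_snd_eq h] at hq hq'
      have r := h3 q.1 hq1 hq.2.1 hq.2.2
      have r' := h3 q'.1 hq1' hq'.2.1 hq'.2.2
      rw [← hq.1] at r
      rw [← hq'.1] at r'
      have e : ((a.1 ⊓ b.1, q.2) : Pt) = (a.1 ⊓ b.1, q'.2) := by rw [hq.1, hq'.1]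
      rw [e] at r
      exact r.symm.trans r'

theorem exists_subdivision_list (X Y : Finset ℝ) (F : List (Pt × Pt))
    (hX : ∀ e ∈ F, (e.1.1 ∈ X ∧ e.1.2 ∈ Y) ∧ e.2.1 ∈ X ∧ e.2.2 ∈ Y)
    (hF : ∀ e ∈ F, e.1.1 = e.2.1 ∨ e.1.2 = e.2.2) :
    ∃ S : Finset (Sym2 Pt), (∀ e ∈ S, IsGridEdge X Y e) ∧
      ∑ e ∈ S, edgeLength e ≤ (F.map fun e => edgeLength s(e.1, e.2)).sum ∧
      ∀ e ∈ F, ∀ q q' : Pt, q ∈ segment ℝ e.1 e.2 → q' ∈ segment ℝ e.1 e.2 → q.1 ∈ X → q.2 ∈ Y →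
        q'.1 ∈ X → q'.2 ∈ Y → (SimpleGraph.fromEdgeSet (S : Set (Sym2 Pt))).Reachable q q' := by
  classical
  induction F with
  | nil => exact ⟨∅, by simp⟩
  | cons e F ih =>
    obtain ⟨S, h1, h2, h3⟩ := ih (fun e he => hX e (List.mem_cons_of_mem _ he))
      (fun e he => hF e (List.mem_cons_of_mem _ he))
    have hX := hX e List.mem_cons_self
    obtain ⟨U, k1, k2, k3⟩ := exists_subdivision_segment X Y e.1 e.2 hX.1 hX.2
      (hF e List.mem_cons_self)
    refine ⟨U ∪ S, ?_, ?_, ?_⟩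
    · intro e he
      rcases Finset.mem_union.1 he with he | he
      exacts [k1 e he, h1 e he]
    · have h := Finset.sum_union_inter (s₁ := U) (s₂ := S) (f := edgeLength)
      have h' : 0 ≤ ∑ e ∈ U ∩ S, edgeLength e :=
        Finset.sum_nonneg fun e _ => edgeLength_nonneg e
      rw [List.map_cons, List.sum_cons]
      linarith
    · intro d hd q q' hq hq' q1 q2 q3 q4
      rcases List.mem_cons.1 hd with rfl | hd
      · exact (k3 q q' hq hq' q1 q2 q3 q4).mono (SimpleGraph.fromEdgeSet_mono (by simp))
      · exact (h3 d hd q q' hq hq' q1 q2 q3 q4).mono (SimpleGraph.fromEdgeSet_mono (by simp))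

theorem IsGridEdge.axis_parallel {X Y : Finset ℝ} {a b : Pt} (h : IsGridEdge X Y s(a, b)) :
    a.1 = b.1 ∨ a.2 = b.2 := by
  rcases h with ⟨x, x', y, -, -, h⟩ | ⟨x, y, y', -, -, h⟩ <;>
  · rw [Sym2.eq_iff] at h
    rcases h with ⟨rfl, rfl⟩ | ⟨rfl, rfl⟩ <;> simp

theorem Consecutive.eq_of_overlap {X : Finset ℝ} {x x' c c' q : ℝ} (h : Consecutive X x x')
    (h' : Consecutive X c c') (hq : q ∈ Set.Icc x x') (hq' : q ∈ Set.Icc c c') :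
    (x = c ∧ x' = c') ∨ ((q = x ∨ q = x') ∧ (q = c ∨ q = c')) := by
  obtain ⟨a1, a2, a3, a4⟩ := h
  obtain ⟨b1, b2, b3, b4⟩ := h'
  obtain ⟨h1, h2⟩ := hq
  obtain ⟨h3, h4⟩ := hq'
  rcases a4 c b1 with k1 | k1
  · rcases b4 x a1 with k2 | k2
    · rcases b4 x' a2 with k3 | k3
      · exact Or.inr ⟨Or.inr (by linarith), Or.inl (by linarith)⟩
      · rcases a4 c' b2 with k4 | k4
        · exact Or.inr ⟨Or.inl (by linarith), Or.inr (by linarith)⟩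
        · exact Or.inl ⟨le_antisymm k2 k1, le_antisymm k4 k3⟩
    · exact Or.inr ⟨Or.inl (by linarith), Or.inr (by linarith)⟩
  · exact Or.inr ⟨Or.inr (by linarith), Or.inl (by linarith)⟩

/-- This is what prevents a horizontal and a vertical grid edge from crossing in an interior point.
-/
theorem Consecutive.eq_of_mem {X : Finset ℝ} {x x' q : ℝ} (h : Consecutive X x x')
    (hq : q ∈ Set.Icc x x') (hq' : q ∈ X) : q = x ∨ q = x' := by
  rcases h.2.2.2 q hq' with h | h
  exacts [Or.inl (le_antisymm h hq.1), Or.inr (le_antisymm hq.2 h)]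

theorem IsGridEdge.embedded {X Y : Finset ℝ} {e e' : Sym2 Pt} (h : IsGridEdge X Y e)
    (h' : IsGridEdge X Y e') (hne : e ≠ e') (q : Pt) (hq : q ∈ edgeSegment e)
    (hq' : q ∈ edgeSegment e') : q ∈ e ∧ q ∈ e' := by
  obtain ⟨u, v⟩ := q
  rcases h with ⟨x, x', y, hx, hy, rfl⟩ | ⟨x, y, y', hy, hx, rfl⟩ <;>
  rcases h' with ⟨c, c', d, hc, hd, rfl⟩ | ⟨c, d, d', hd, hc, rfl⟩
  · rw [edgeSegment_mk, mem_segment_horizontal, Set.uIcc_of_le hx.2.2.1.le] at hq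
    rw [edgeSegment_mk, mem_segment_horizontal, Set.uIcc_of_le hc.2.2.1.le] at hq'
    obtain ⟨rfl, hq⟩ := hq
    obtain ⟨rfl, hq'⟩ := hq'
    rcases hx.eq_of_overlap hc hq hq' with ⟨rfl, rfl⟩ | h
    · exact absurd rfl hne
    · simpa using h
  · rw [edgeSegment_mk, mem_segment_horizontal, Set.uIcc_of_le hx.2.2.1.le] at hq
    rw [edgeSegment_mk, mem_segment_vertical, Set.uIcc_of_le hd.2.2.1.le] at hq'
    obtain ⟨rfl, hq⟩ := hq
    obtain ⟨rfl, hq'⟩ := hq'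
    have h1 := hx.eq_of_mem hq hc
    have h2 := hd.eq_of_mem hq' hy
    simpa using ⟨h1, h2⟩
  · rw [edgeSegment_mk, mem_segment_vertical, Set.uIcc_of_le hy.2.2.1.le] at hq
    rw [edgeSegment_mk, mem_segment_horizontal, Set.uIcc_of_le hc.2.2.1.le] at hq'
    obtain ⟨rfl, hq⟩ := hq
    obtain ⟨rfl, hq'⟩ := hq'
    have h1 := hc.eq_of_mem hq' hx
    have h2 := hy.eq_of_mem hq hd
    simpa using ⟨h2, h1⟩
  · rw [edgeSegment_mk, mem_segment_vertical, Set.uIcc_of_le hy.2.2.1.le] at hq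
    rw [edgeSegment_mk, mem_segment_vertical, Set.uIcc_of_le hd.2.2.1.le] at hq'
    obtain ⟨rfl, hq⟩ := hq
    obtain ⟨rfl, hq'⟩ := hq'
    rcases hy.eq_of_overlap hd hq hq' with ⟨rfl, rfl⟩ | h
    · exact absurd rfl hne
    · simpa using h

/-- The points `q` and `q'` of `N` lie on a common segment of the list `F`. -/
def Linked (F : List (Pt × Pt)) (N : Finset Pt) (q q' : Pt) : Prop :=
  q ∈ N ∧ q' ∈ N ∧ ∃ e ∈ F, q ∈ segment ℝ e.1 e.2 ∧ q' ∈ segment ℝ e.1 e.2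

/-- A family of axis-parallel segments that connects `P` contains a rectilinear Steiner tree that
is at most as long. -/
theorem exists_steinerTree_of_linked (P : Set Pt) (hP : P.Nontrivial) (F : List (Pt × Pt))
    (hF : ∀ e ∈ F, e.1.1 = e.2.1 ∨ e.1.2 = e.2.2) (N : Finset Pt) (o : Pt)
    (hconn : ∀ p ∈ P, Relation.ReflTransGen (Linked F N) p o) :
    ∃ T : RectTree, IsSteinerTree P T ∧
      T.length ≤ (F.map fun e => edgeLength s(e.1, e.2)).sum := by
  classical
  -- The grid also contains the endpoints of all segments, so that each segment is a union of grid
  -- edges.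
  set M : Finset Pt := N ∪ (F.map Prod.fst).toFinset ∪ (F.map Prod.snd).toFinset with hM
  have hMX : ∀ q ∈ M, q.1 ∈ M.image Prod.fst ∧ q.2 ∈ M.image Prod.snd := fun q hq =>
    ⟨Finset.mem_image_of_mem _ hq, Finset.mem_image_of_mem _ hq⟩
  obtain ⟨S, hS, hlen, hreach⟩ := exists_subdivision_list (M.image Prod.fst) (M.image Prod.snd) F
    (fun e he => ⟨hMX _ (by simp only [hM, Finset.mem_union, List.mem_toFinset, List.mem_map]
                            exact Or.inl (Or.inr ⟨e, he, rfl⟩)),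
      hMX _ (by simp only [hM, Finset.mem_union, List.mem_toFinset, List.mem_map]
                exact Or.inr ⟨e, he, rfl⟩)⟩) hF
  have hNM : ∀ q ∈ N, q ∈ M := fun q hq => by simp [hM, hq]
  have hlink : ∀ q q', Relation.ReflTransGen (Linked F N) q q' →
      (SimpleGraph.fromEdgeSet (S : Set (Sym2 Pt))).Reachable q q' := by
    intro q q' h
    induction h with
    | refl => exact SimpleGraph.Reachable.rfl
    | tail _ h ih =>
      obtain ⟨h1, h2, e, he, h3, h4⟩ := h
      have k1 := hMX _ (hNM _ h1)
      have k2 := hMX _ (hNM _ h2)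
      exact ih.trans (hreach e he _ _ h3 h4 k1.1 k1.2 k2.1 k2.2)
  -- A spanning forest of the subdivided figure; `G` below is its component of `o`. Grid edges are
  -- embedded, so any subgraph of them is.
  obtain ⟨H, hHle, hHac, hHr⟩ :=
    (SimpleGraph.fromEdgeSet (S : Set (Sym2 Pt))).exists_isAcyclic_reachable_eq_le
  let G : SimpleGraph Pt :=
    { Adj := fun a b => H.Adj a b ∧ H.Reachable o a
      symm := ⟨fun a b h => ⟨h.1.symm, h.2.trans h.1.reachable⟩⟩
      loopless := ⟨fun a h => H.loopless.irrefl a h.1⟩ }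
  have hGH : G ≤ H := fun a b h => h.1
  have hGS : ∀ e ∈ G.edgeSet, e ∈ S := by
    intro e he
    induction e with
    | _ a b =>
      have := hHle (hGH he)
      rw [SimpleGraph.fromEdgeSet_adj] at this
      exact this.1
  have hGr : ∀ a, H.Reachable o a → G.Reachable o a := by
    intro a h
    rw [SimpleGraph.reachable_iff_reflTransGen] at h
    induction h with
    | refl => exact SimpleGraph.Reachable.rfl
    | tail h1 h2 ih =>
      refine ih.trans (SimpleGraph.Adj.reachable ⟨h2, ?_⟩)
      rw [SimpleGraph.reachable_iff_reflTransGen]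
      exact h1
  have hPr : ∀ p ∈ P, G.Reachable o p := fun p hp => hGr p (by
    rw [hHr]
    exact (hlink p o (hconn p hp)).symm)
  have hsupp : P ⊆ G.support := by
    intro p hp
    obtain ⟨q, hq, hne⟩ := hP.exists_ne p
    have h := (hPr p hp).symm.trans (hPr q hq)
    rw [SimpleGraph.reachable_iff_reflTransGen] at h
    rcases Relation.ReflTransGen.cases_head h with h | ⟨c, h, -⟩
    · exact absurd h.symm hne
    · exact ⟨c, h⟩
  have hfin : G.edgeSet.Finite := S.finite_toSet.subset hGS
  have hone : ∀ a ∈ G.support, G.Reachable o a := fun a ⟨b, h⟩ => hGr a h.2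
  refine ⟨⟨G, hfin, ?_, hHac.anti hGH, fun a ha b hb => (hone a ha).symm.trans (hone b hb), ?_, ?_⟩,
    hsupp, ?_⟩
  · obtain ⟨p, hp⟩ := hP.nonempty
    obtain ⟨b, h⟩ := hsupp hp
    exact ⟨s(p, b), h⟩
  · exact fun a b h => (hS _ (hGS s(a, b) h)).axis_parallel
  · exact fun e he e' he' hne q hq hq' =>
      (hS e (hGS e he)).embedded (hS e' (hGS e' he')) hne q hq hq'
  · refine le_trans ?_ hlen
    refine Finset.sum_le_sum_of_subset_of_nonneg ?_ fun e _ _ => edgeLength_nonneg e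
    intro e he
    exact hGS e (hfin.mem_toFinset.1 he)

/-! ### Full components -/

theorem IsTerminalFreeSubtree.exists_adj {P : Set Pt} {T : RectTree} {C : T.graph.Subgraph}
    (h : IsTerminalFreeSubtree P T C) {q : Pt} (hq : q ∈ C.verts) : ∃ q', C.Adj q q' := by
  obtain ⟨e, he⟩ := h.2.1
  induction e with
  | _ a b =>
    have hab : C.Adj a b := he
    obtain ⟨c, hc, hne⟩ : ∃ c ∈ C.verts, q ≠ c := by
      by_cases hqa : q = a
      · exact ⟨b, hab.snd_mem, hqa ▸ hab.ne⟩
      · exact ⟨a, hab.fst_mem, hqa⟩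
    have hr := h.1.preconnected ⟨q, hq⟩ ⟨c, hc⟩
    rw [SimpleGraph.reachable_iff_reflTransGen] at hr
    rcases Relation.ReflTransGen.cases_head hr with h | ⟨d, h, -⟩
    · exact absurd (congrArg Subtype.val h) hne
    · exact ⟨d, h⟩

/-- Such a subtree has no isolated nodes, hence is determined by its edge set, a subset of a finite
set. Finiteness is what allows every edge to be extended to a full component. -/
theorem finite_setOf_isTerminalFreeSubtree (P : Set Pt) (T : RectTree) :
    {C : T.graph.Subgraph | IsTerminalFreeSubtree P T C}.Finite := by
  refine Set.Finite.of_finite_image (f := fun C => C.edgeSet)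
    (T.finite_edges.finite_subsets.subset ?_) ?_
  · rintro _ ⟨C, -, rfl⟩
    exact C.edgeSet_subset
  · have key : ∀ C D : T.graph.Subgraph, IsTerminalFreeSubtree P T C → C.edgeSet = D.edgeSet →
        C ≤ D := by
      intro C D hC h
      have hadj : ∀ a b, C.Adj a b → D.Adj a b := fun a b hab => by
        have : s(a, b) ∈ C.edgeSet := hab
        rw [h] at this
        exact this
      refine ⟨fun q hq => ?_, hadj⟩
      obtain ⟨q', hq'⟩ := hC.exists_adj hq
      exact (hadj _ _ hq').fst_mem
    exact fun C hC D hD h => le_antisymm (key C D hC h) (key D C hD h.symm)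

theorem exists_isFullComponent_of_adj (P : Set Pt) (T : RectTree) {a b : Pt}
    (h : T.graph.Adj a b) : ∃ C : T.graph.Subgraph, IsFullComponent P T C ∧ C.Adj a b := by
  have h0 : IsTerminalFreeSubtree P T (T.graph.subgraphOfAdj h) := by
    refine ⟨SimpleGraph.Subgraph.subgraphOfAdj_connected h, ⟨s(a, b), by simp⟩, fun p _ => ?_⟩
    intro x hx y hy
    simp only [SimpleGraph.Subgraph.mem_neighborSet, SimpleGraph.subgraphOfAdj_adj,
      Sym2.eq_iff] at hx hy
    have := h.ne
    grind
  obtain ⟨C, hle, hC⟩ := (finite_setOf_isTerminalFreeSubtree P T).exists_le_maximal h0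
  exact ⟨C, hC, hle.2 (by simp)⟩

/-- Local statements about a component pass to the whole tree through this: at a non-terminal node
both have the same edges. If the other end is already in `C`, a missing edge would close a cycle;
otherwise the edge could be added to `C`, because its far end gets degree one there and no other
terminal is affected. -/
theorem IsFullComponent.adj_of_notMem {P : Set Pt} {T : RectTree} {C : T.graph.Subgraph}
    (hC : IsFullComponent P T C) {q q' : Pt} (hq : q ∈ C.verts) (hqP : q ∉ P)
    (h : T.graph.Adj q q') : C.Adj q q' := by
  have hC0 : IsTerminalFreeSubtree P T C := hC.1
  have hcyc : q' ∈ C.verts → C.Adj q q' := by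
    intro hq'
    by_contra hn
    have hb := SimpleGraph.isAcyclic_iff_forall_adj_isBridge.1 T.acyclic h
    rw [SimpleGraph.isBridge_iff] at hb
    apply hb
    have hr := hC0.1.preconnected ⟨q, hq⟩ ⟨q', hq'⟩
    let f : C.coe →g T.graph.deleteEdges {s(q, q')} :=
      { toFun := Subtype.val
        map_rel' := by
          intro x y hxy
          have hxy : C.Adj x y := hxy
          rw [SimpleGraph.deleteEdges_adj]
          refine ⟨hxy.adj_sub, fun he => ?_⟩
          rw [Set.mem_singleton_iff, Sym2.eq_iff] at he
          rcases he with ⟨h1, h2⟩ | ⟨h1, h2⟩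
          · rw [h1, h2] at hxy
            exact hn hxy
          · rw [h1, h2] at hxy
            exact hn hxy.symm }
    exact hr.map f
  by_cases hq' : q' ∈ C.verts
  · exact hcyc hq'
  have hD : IsTerminalFreeSubtree P T (C ⊔ T.graph.subgraphOfAdj h) := by
    refine ⟨SimpleGraph.Subgraph.connected_sup hC0.1.preconnected
      (SimpleGraph.Subgraph.subgraphOfAdj_connected h).preconnected ⟨q, hq, by simp⟩,
      hC0.2.1.mono (SimpleGraph.Subgraph.edgeSet_mono le_sup_left), fun p hp => ?_⟩
    have hpq : p ≠ q := fun h => hqP (h ▸ hp)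
    intro x hx y hy
    simp only [SimpleGraph.Subgraph.mem_neighborSet, SimpleGraph.Subgraph.sup_adj,
      SimpleGraph.subgraphOfAdj_adj, Sym2.eq_iff] at hx hy
    by_cases hpq' : p = q'
    · subst hpq'
      have hno : ∀ z, ¬C.Adj p z := fun z hz => hq' hz.fst_mem
      have hx' := hno x
      have hy' := hno y
      grind
    · have hx' : C.Adj p x := by grind
      have hy' : C.Adj p y := by grind
      exact hC0.2.2 p hp hx' hy'
  exact (hC.2 hD le_sup_left).2 (by simp)

/-! ### The local structure of full components -/

/-- In the edge set `E`, the node `q` has an edge in direction `d`. -/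
def HasEdge (E : Set (Sym2 Pt)) (d q : Pt) : Prop := ∃ c : ℝ, 0 < c ∧ s(q, q + c • d) ∈ E

/-- `b` is reached from `a` by an edge of `E` in direction `d`. -/
def Step (E : Set (Sym2 Pt)) (d a b : Pt) : Prop := ∃ c : ℝ, 0 < c ∧ b = a + c • d ∧ s(a, b) ∈ E

/-- A sequence of edges in direction `d` leads from `q` to a point of `P`. -/
def LeadsTo (P : Set Pt) (E : Set (Sym2 Pt)) (d q : Pt) : Prop :=
  ∃ p ∈ P, Relation.ReflTransGen (Step E d) q p

/-- The vertical line and the horizontal line through `q` both contain a point of `P`. -/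
def Aligned (P : Set Pt) (q : Pt) : Prop := (∃ p ∈ P, p.1 = q.1) ∧ ∃ p ∈ P, p.2 = q.2

/-- At the node `q`, every edge that is not continued in the opposite direction leads to a point of
`P`, and there is an edge perpendicular to it. -/
def GoodNode (P : Set Pt) (E : Set (Sym2 Pt)) (q : Pt) : Prop :=
  ∀ u w, IsAxisFrame u w → HasEdge E w q → ¬HasEdge E (-w) q →
    LeadsTo P E w q ∧ (HasEdge E u q ∨ HasEdge E (-u) q)

/-- The nodes `q` and `q'` of a segment have edges incident from different sides only. -/
def Alternate (E : Set (Sym2 Pt)) (q q' : Pt) : Prop :=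
  ∃ u w, IsAxisFrame u w ∧ (∃ c : ℝ, q' = q + c • u) ∧
    HasEdge E w q ∧ ¬HasEdge E (-w) q ∧ HasEdge E (-w) q' ∧ ¬HasEdge E w q'

/-- The local properties that the four types of full components have in common. -/
structure IsLocallyAlternating (P : Set Pt) (E : Set (Sym2 Pt)) : Prop where
  aligned : ∀ q q', s(q, q') ∈ E → Aligned P q
  good : ∀ q q', s(q, q') ∈ E → q ∉ P → GoodNode P E q
  alternate : ∀ q q', s(q, q') ∈ E → q ∉ P → q' ∉ P → Alternate E q q'

theorem IsAxisFrame.neg_right {u w : Pt} (h : IsAxisFrame u w) : IsAxisFrame u (-w) := by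
  rcases h with ⟨hu, rfl | rfl⟩ | ⟨hu, rfl | rfl⟩ <;> simp [IsAxisFrame, hu]

theorem IsAxisFrame.symm {u w : Pt} (h : IsAxisFrame u w) : IsAxisFrame w u := by
  rcases h with ⟨h1, h2⟩ | ⟨h1, h2⟩
  exacts [Or.inr ⟨h2, h1⟩, Or.inl ⟨h2, h1⟩]

theorem IsAxisFrame.eq_or_eq_neg {d e u w : Pt} (h : IsAxisFrame d e) (h' : IsAxisFrame u w) :
    ((u = d ∨ u = -d) ∧ (w = e ∨ w = -e)) ∨ ((u = e ∨ u = -e) ∧ (w = d ∨ w = -d)) := by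
  rcases h with ⟨rfl | rfl, rfl | rfl⟩ | ⟨rfl | rfl, rfl | rfl⟩ <;>
  rcases h' with ⟨rfl | rfl, rfl | rfl⟩ | ⟨rfl | rfl, rfl | rfl⟩ <;> simp

theorem Alternate.symm {E : Set (Sym2 Pt)} {q q' : Pt} (h : Alternate E q q') :
    Alternate E q' q := by
  obtain ⟨u, w, hf, ⟨c, rfl⟩, h1, h2, h3, h4⟩ := h
  refine ⟨u, -w, hf.neg_right, ⟨-c, by simp⟩, h3, by rwa [neg_neg], by rwa [neg_neg], h2⟩

/-- The two edges of the bar oppose each other, so the condition is only about the stem. -/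
theorem goodNode_of_tee {P : Set Pt} {E : Set (Sym2 Pt)} {q d e : Pt} (hf : IsAxisFrame d e)
    (h1 : HasEdge E d q) (h2 : HasEdge E (-d) q) (h3 : HasEdge E e q) (h4 : LeadsTo P E e q) :
    GoodNode P E q := by
  intro u w huw hw hw'
  rcases hf.eq_or_eq_neg huw with ⟨rfl | rfl, rfl | rfl⟩ | ⟨rfl | rfl, rfl | rfl⟩
  all_goals simp_all

theorem goodNode_of_corner {P : Set Pt} {E : Set (Sym2 Pt)} {q d e : Pt} (hf : IsAxisFrame d e)
    (h1 : HasEdge E d q) (h2 : ¬HasEdge E (-d) q) (h3 : HasEdge E e q) (h4 : ¬HasEdge E (-e) q)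
    (h5 : LeadsTo P E d q) (h6 : LeadsTo P E e q) : GoodNode P E q := by
  intro u w huw hw hw'
  rcases hf.eq_or_eq_neg huw with ⟨rfl | rfl, rfl | rfl⟩ | ⟨rfl | rfl, rfl | rfl⟩
  all_goals simp_all

theorem goodNode_of_cross {P : Set Pt} {E : Set (Sym2 Pt)} {q d e : Pt} (hf : IsAxisFrame d e)
    (h1 : HasEdge E d q) (h2 : HasEdge E (-d) q) (h3 : HasEdge E e q) (h4 : HasEdge E (-e) q) :
    GoodNode P E q := by
  intro u w huw hw hw'
  rcases hf.eq_or_eq_neg huw with ⟨rfl | rfl, rfl | rfl⟩ | ⟨rfl | rfl, rfl | rfl⟩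
  all_goals simp_all

theorem IsCross.isLocallyAlternating {P : Set Pt} {E : Set (Sym2 Pt)} (h : IsCross P E) :
    IsLocallyAlternating P E := by
  obtain ⟨z, a, b, c, d, ha, hb, hc, hd, h1, h2, h3, h4, rfl⟩ := h
  have hmem : ∀ q q', s(q, q') ∈ ({s(z, z + (a, 0)), s(z, z + (-b, 0)), s(z, z + (0, c)),
      s(z, z + (0, -d))} : Set (Sym2 Pt)) → (q = z ∧ q' ∈ P) ∨ q ∈ P := by
    intro q q' h
    simp only [Set.mem_insert_iff, Set.mem_singleton_iff, Sym2.eq_iff] at h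
    rcases h with (⟨rfl, rfl⟩ | ⟨rfl, rfl⟩) | (⟨rfl, rfl⟩ | ⟨rfl, rfl⟩) |
      (⟨rfl, rfl⟩ | ⟨rfl, rfl⟩) | (⟨rfl, rfl⟩ | ⟨rfl, rfl⟩) <;> simp [*]
  refine ⟨fun q q' h => ?_, fun q q' h hq => ?_, fun q q' h hq hq' => ?_⟩
  · rcases hmem q q' h with ⟨rfl, -⟩ | h
    · exact ⟨⟨_, h3, by simp⟩, ⟨_, h1, by simp⟩⟩
    · exact ⟨⟨q, h, rfl⟩, ⟨q, h, rfl⟩⟩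
  · rcases hmem q q' h with ⟨rfl, -⟩ | h
    · refine goodNode_of_cross (d := (1, 0)) (e := (0, 1)) (by simp [IsAxisFrame])
        ⟨a, ha, ?_⟩ ⟨b, hb, ?_⟩ ⟨c, hc, ?_⟩ ⟨d, hd, ?_⟩ <;> simp
    · exact absurd h hq
  · rcases hmem q q' h with ⟨-, h⟩ | h
    exacts [absurd h hq', absurd h hq]

/-- The point with coordinates `α`, `β` in the frame `u`, `w` at `z`. -/
def framePt (z u w : Pt) (α β : ℝ) : Pt := z + α • u + β • w

theorem framePt_inj {z u w : Pt} (hf : IsAxisFrame u w) {α β α' β' : ℝ} :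
    framePt z u w α β = framePt z u w α' β' ↔ α = α' ∧ β = β' := by
  rcases hf with ⟨rfl | rfl, rfl | rfl⟩ | ⟨rfl | rfl, rfl | rfl⟩ <;>
  simp [framePt, Prod.ext_iff, and_comm]

theorem framePt_add_left (z u w : Pt) (α β c : ℝ) :
    framePt z u w α β + c • u = framePt z u w (α + c) β := by
  simp only [framePt]; module

theorem framePt_add_right (z u w : Pt) (α β c : ℝ) :
    framePt z u w α β + c • w = framePt z u w α (β + c) := by
  simp only [framePt]; module

theorem framePt_sub_left (z u w : Pt) (α β c : ℝ) :
    framePt z u w α β + c • (-u) = framePt z u w (α - c) β := by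
  simp only [framePt]; module

theorem framePt_sub_right (z u w : Pt) (α β c : ℝ) :
    framePt z u w α β + c • (-w) = framePt z u w α (β - c) := by
  simp only [framePt]; module

theorem aligned_framePt {P : Set Pt} {z u w : Pt} (hf : IsAxisFrame u w) {α β α' β' : ℝ}
    (h1 : framePt z u w α β' ∈ P) (h2 : framePt z u w α' β ∈ P) :
    Aligned P (framePt z u w α β) := by
  rcases hf with ⟨rfl | rfl, rfl | rfl⟩ | ⟨rfl | rfl, rfl | rfl⟩
  iterate 4 exact ⟨⟨_, h1, by simp [framePt]⟩, ⟨_, h2, by simp [framePt]⟩⟩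
  iterate 4 exact ⟨⟨_, h2, by simp [framePt]⟩, ⟨_, h1, by simp [framePt]⟩⟩

theorem mem_combEdges_iff {z u w : Pt} {k : ℕ} {t h : ℕ → ℝ} {e : Sym2 Pt} :
    e ∈ combEdges z u w k t h ↔
      (∃ j, j ≤ k ∧ e = s(framePt z u w (t j) 0, framePt z u w (t (j + 1)) 0)) ∨
      ∃ j, 1 ≤ j ∧ j ≤ k ∧ e = s(framePt z u w (t j) 0, framePt z u w (t j) (h j)) := by
  simp [combEdges, framePt]

/-! ### Combs with further edges `X` that lie behind or at the start -/

section Comb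

variable {P : Set Pt} {z u w : Pt} {k : ℕ} {t h : ℕ → ℝ}

theorem IsAlternatingComb.lt (hc : IsAlternatingComb P z u w k t h) {i j : ℕ} (hij : i < j)
    (hj : j ≤ k + 1) : t i < t j := by
  induction j, hij using Nat.le_induction with
  | base => exact hc.increasing i (by omega)
  | succ j hij ih => exact (ih (by omega)).trans (hc.increasing j (by omega))

theorem IsAlternatingComb.pos (hc : IsAlternatingComb P z u w k t h) {j : ℕ} (h1 : 1 ≤ j)
    (hj : j ≤ k + 1) : 0 < t j := by
  rw [← hc.start]
  exact hc.lt h1 hj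

theorem IsAlternatingComb.eq_of_eq (hc : IsAlternatingComb P z u w k t h) {i j : ℕ}
    (hi : i ≤ k + 1) (hj : j ≤ k + 1) (h : t i = t j) : i = j := by
  rcases lt_trichotomy i j with hlt | rfl | hlt
  · exact absurd h (hc.lt hlt hj).ne
  · rfl
  · exact absurd h (hc.lt hlt hi).ne'

theorem IsAlternatingComb.end_mem (hc : IsAlternatingComb P z u w k t h) :
    framePt z u w (t (k + 1)) 0 ∈ P := by
  simpa [framePt] using hc.end_terminal

theorem IsAlternatingComb.tip_mem (hc : IsAlternatingComb P z u w k t h) {j : ℕ} (h1 : 1 ≤ j)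
    (hj : j ≤ k) : framePt z u w (t j) (h j) ∈ P := hc.tip_terminal j h1 hj

variable {X : Set (Sym2 Pt)}

theorem hasEdge_comb_succ (hc : IsAlternatingComb P z u w k t h) {j : ℕ} (hj : j ≤ k) :
    HasEdge (combEdges z u w k t h ∪ X) u (framePt z u w (t j) 0) := by
  refine ⟨t (j + 1) - t j, sub_pos.2 (hc.increasing j hj), Or.inl ?_⟩
  rw [framePt_add_left, mem_combEdges_iff]
  exact Or.inl ⟨j, hj, by rw [add_sub_cancel]⟩

theorem hasEdge_comb_pred (hc : IsAlternatingComb P z u w k t h) {j : ℕ} (h1 : 1 ≤ j)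
    (hj : j ≤ k) : HasEdge (combEdges z u w k t h ∪ X) (-u) (framePt z u w (t j) 0) := by
  obtain ⟨i, rfl⟩ := Nat.exists_eq_add_of_le' h1
  refine ⟨t (i + 1) - t i, sub_pos.2 (hc.increasing i (by omega)), Or.inl ?_⟩
  rw [framePt_sub_left, mem_combEdges_iff]
  exact Or.inl ⟨i, by omega, by rw [sub_sub_cancel, Sym2.eq_swap]⟩

theorem reflTransGen_step_comb (hc : IsAlternatingComb P z u w k t h) :
    LeadsTo P (combEdges z u w k t h ∪ X) u z := by
  have key : ∀ j ≤ k + 1, Relation.ReflTransGen (Step (combEdges z u w k t h ∪ X) u) z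
      (framePt z u w (t j) 0) := by
    intro j hj
    induction j with
    | zero => simp [framePt, hc.start, Relation.ReflTransGen.refl]
    | succ j ih =>
      refine (ih (by omega)).tail ⟨t (j + 1) - t j, sub_pos.2 (hc.increasing j (by omega)), ?_,
        Or.inl ?_⟩
      · rw [framePt_add_left, add_sub_cancel]
      · rw [mem_combEdges_iff]
        exact Or.inl ⟨j, by omega, rfl⟩
  exact ⟨_, hc.end_mem, key _ le_rfl⟩

/-- The node `j` of a comb has an incident edge in direction `e`, and none in direction `-e`. -/
theorem exists_stem (hf : IsAxisFrame u w) (hc : IsAlternatingComb P z u w k t h)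
    (hX : ∀ α β α' β', s(framePt z u w α β, framePt z u w α' β') ∈ X → α ≤ 0 ∧ α' ≤ 0)
    {j : ℕ} (h1 : 1 ≤ j) (hj : j ≤ k) {e : Pt} (he : (Even j ∧ e = w) ∨ (¬Even j ∧ e = -w)) :
    LeadsTo P (combEdges z u w k t h ∪ X) e (framePt z u w (t j) 0) ∧
      HasEdge (combEdges z u w k t h ∪ X) e (framePt z u w (t j) 0) ∧
      ¬HasEdge (combEdges z u w k t h ∪ X) (-e) (framePt z u w (t j) 0) := by
  have htip := hc.tip_mem h1 hj
  have hpos := hc.pos h1 (by omega : j ≤ k + 1)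
  have halt := hc.alternating j h1 hj
  have hmem : s(framePt z u w (t j) 0, framePt z u w (t j) (h j)) ∈
      combEdges z u w k t h ∪ X := Or.inl (mem_combEdges_iff.2 (Or.inr ⟨j, h1, hj, rfl⟩))
  -- The sign condition says that `β` points away from the incident edge. Edges of `X` stay at
  -- coordinates at most `0`, whereas `t j` is positive, so they cannot occur here.
  have hno : ∀ β, β * h j < 0 → s(framePt z u w (t j) 0, framePt z u w (t j) β) ∉
      combEdges z u w k t h ∪ X := by
    rintro β hβ (hm | hm)
    · rw [mem_combEdges_iff] at hm
      simp only [Sym2.eq_iff, framePt_inj hf] at hm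
      rcases hm with ⟨i, hi, hm⟩ | ⟨i, hi1, hi, hm⟩
      · have : β = 0 := by rcases hm with h | h; exacts [h.2.2, h.2.2]
        simp [this] at hβ
      · rcases hm with ⟨⟨h2, -⟩, -, h3⟩ | ⟨⟨h2, h3⟩, -⟩
        · rw [hc.eq_of_eq (by omega) (by omega) h2, h3] at hβ
          nlinarith [mul_self_nonneg (h i)]
        · have := hc.alternating i hi1 hi
          rw [← h3] at this
          simp at this
    · exact absurd (hX _ _ _ _ hm).1 (not_le.2 hpos)
  rcases he with ⟨hev, rfl⟩ | ⟨hev, rfl⟩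
  · rw [hev.neg_one_pow, one_mul] at halt
    have hadd : framePt z u e (t j) 0 + h j • e = framePt z u e (t j) (h j) := by
      rw [framePt_add_right, zero_add]
    refine ⟨⟨_, htip, .single ⟨h j, halt, hadd.symm, hmem⟩⟩, ⟨h j, halt, by rwa [hadd]⟩, ?_⟩
    rintro ⟨c, hc0, hm⟩
    rw [framePt_sub_right, zero_sub] at hm
    exact hno _ (by nlinarith) hm
  · rw [(Nat.not_even_iff_odd.1 hev).neg_one_pow, neg_one_mul] at halt
    have hadd : framePt z u w (t j) 0 + (-h j) • (-w) = framePt z u w (t j) (h j) := by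
      rw [framePt_sub_right, zero_sub, neg_neg]
    refine ⟨⟨_, htip, .single ⟨-h j, halt, hadd.symm, hmem⟩⟩, ⟨-h j, halt, by rwa [hadd]⟩, ?_⟩
    rintro ⟨c, hc0, hm⟩
    rw [neg_neg, framePt_add_right, zero_add] at hm
    exact hno _ (by nlinarith) hm

theorem goodNode_comb (hf : IsAxisFrame u w) (hc : IsAlternatingComb P z u w k t h)
    (hX : ∀ α β α' β', s(framePt z u w α β, framePt z u w α' β') ∈ X → α ≤ 0 ∧ α' ≤ 0)
    {j : ℕ} (h1 : 1 ≤ j) (hj : j ≤ k) :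
    GoodNode P (combEdges z u w k t h ∪ X) (framePt z u w (t j) 0) := by
  by_cases hev : Even j
  · obtain ⟨h2, h3, -⟩ := exists_stem hf hc hX h1 hj (e := w) (Or.inl ⟨hev, rfl⟩)
    exact goodNode_of_tee hf (hasEdge_comb_succ hc hj) (hasEdge_comb_pred hc h1 hj) h3 h2
  · obtain ⟨h2, h3, -⟩ := exists_stem hf hc hX h1 hj (e := -w) (Or.inr ⟨hev, rfl⟩)
    exact goodNode_of_tee hf.neg_right (hasEdge_comb_succ hc hj) (hasEdge_comb_pred hc h1 hj) h3 h2

theorem alternate_comb (hf : IsAxisFrame u w) (hc : IsAlternatingComb P z u w k t h)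
    (hX : ∀ α β α' β', s(framePt z u w α β, framePt z u w α' β') ∈ X → α ≤ 0 ∧ α' ≤ 0)
    {j : ℕ} (h1 : 1 ≤ j) (hj : j + 1 ≤ k) :
    Alternate (combEdges z u w k t h ∪ X) (framePt z u w (t j) 0)
      (framePt z u w (t (j + 1)) 0) := by
  have hstep : framePt z u w (t (j + 1)) 0 = framePt z u w (t j) 0 + (t (j + 1) - t j) • u := by
    rw [framePt_add_left, add_sub_cancel]
  by_cases hev : Even j
  · obtain ⟨-, h2, h3⟩ := exists_stem hf hc hX h1 (by omega) (e := w) (Or.inl ⟨hev, rfl⟩)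
    obtain ⟨-, h4, h5⟩ := exists_stem hf hc hX (by omega) hj (e := -w)
      (Or.inr ⟨by simpa [Nat.even_add_one] using hev, rfl⟩)
    rw [neg_neg] at h5
    exact ⟨u, w, hf, ⟨_, hstep⟩, h2, h3, h4, h5⟩
  · obtain ⟨-, h2, h3⟩ := exists_stem hf hc hX h1 (by omega) (e := -w) (Or.inr ⟨hev, rfl⟩)
    obtain ⟨-, h4, h5⟩ := exists_stem hf hc hX (by omega) hj (e := w)
      (Or.inl ⟨by simpa [Nat.even_add_one] using hev, rfl⟩)
    exact ⟨u, -w, hf.neg_right, ⟨_, hstep⟩, h2, h3, by rwa [neg_neg], h5⟩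

/-- The short leg plays the role of an incident edge at position zero: it points to `w`, and the
first incident edge, of odd index, points to `-w`. -/
theorem alternate_corner (hf : IsAxisFrame u w) (hc : IsAlternatingComb P z u w k t h)
    (hX : ∀ α β α' β', s(framePt z u w α β, framePt z u w α' β') ∈ X → α ≤ 0 ∧ α' ≤ 0)
    (hk : 1 ≤ k) (h1 : HasEdge (combEdges z u w k t h ∪ X) w z)
    (h2 : ¬HasEdge (combEdges z u w k t h ∪ X) (-w) z) :
    Alternate (combEdges z u w k t h ∪ X) z (framePt z u w (t 1) 0) := by
  obtain ⟨-, h4, h5⟩ := exists_stem hf hc hX le_rfl hk (e := -w) (Or.inr ⟨by simp, rfl⟩)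
  rw [neg_neg] at h5
  exact ⟨u, w, hf, ⟨t 1, by simp [framePt]⟩, h1, h2, h4, h5⟩

theorem aligned_comb (hf : IsAxisFrame u w) (hc : IsAlternatingComb P z u w k t h)
    {β : ℝ} (hβ : framePt z u w 0 β ∈ P) {j : ℕ} (hj : j ≤ k + 1) :
    Aligned P (framePt z u w (t j) 0) := by
  rcases Nat.eq_zero_or_pos j with rfl | h1
  · rw [hc.start]
    exact aligned_framePt hf hβ hc.end_mem
  · rcases hj.eq_or_lt with rfl | hj
    · exact aligned_framePt hf hc.end_mem hc.end_mem
    · exact aligned_framePt hf (hc.tip_mem h1 (by omega)) hc.end_mem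

/-- It suffices to consider the corner of a comb and the further edges. -/
theorem isLocallyAlternating_comb (hf : IsAxisFrame u w) (hc : IsAlternatingComb P z u w k t h)
    (hX : ∀ α β α' β', s(framePt z u w α β, framePt z u w α' β') ∈ X → α ≤ 0 ∧ α' ≤ 0)
    {β : ℝ} (hβ : framePt z u w 0 β ∈ P)
    (hz : z ∉ P → GoodNode P (combEdges z u w k t h ∪ X) z ∧
      HasEdge (combEdges z u w k t h ∪ X) w z ∧ ¬HasEdge (combEdges z u w k t h ∪ X) (-w) z)
    (hXn : ∀ q q', s(q, q') ∈ X → Aligned P q ∧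
      (q ∉ P → GoodNode P (combEdges z u w k t h ∪ X) q) ∧
      (q ∉ P → q' ∉ P → Alternate (combEdges z u w k t h ∪ X) q q')) :
    IsLocallyAlternating P (combEdges z u w k t h ∪ X) := by
  have hz0 : framePt z u w (t 0) 0 = z := by simp [framePt, hc.start]
  have hgood : ∀ j ≤ k + 1, framePt z u w (t j) 0 ∉ P →
      GoodNode P (combEdges z u w k t h ∪ X) (framePt z u w (t j) 0) := by
    intro j hj hjP
    rcases Nat.eq_zero_or_pos j with rfl | h1
    · rw [hz0] at hjP ⊢
      exact (hz hjP).1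
    · rcases hj.eq_or_lt with rfl | hj
      · exact absurd hc.end_mem hjP
      · exact goodNode_comb hf hc hX h1 (by omega)
  have halt : ∀ j ≤ k, framePt z u w (t j) 0 ∉ P → framePt z u w (t (j + 1)) 0 ∉ P →
      Alternate (combEdges z u w k t h ∪ X) (framePt z u w (t j) 0)
        (framePt z u w (t (j + 1)) 0) := by
    intro j hj hjP hjP'
    rcases hj.eq_or_lt with rfl | hj
    · exact absurd hc.end_mem hjP'
    rcases Nat.eq_zero_or_pos j with rfl | h1
    · rw [hz0] at hjP ⊢
      exact alternate_corner hf hc hX hj (hz hjP).2.1 (hz hjP).2.2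
    · exact alternate_comb hf hc hX h1 hj
  refine ⟨fun q q' he => ?_, fun q q' he hq => ?_, fun q q' he hq hq' => ?_⟩
  · rcases he with he | he
    · rw [mem_combEdges_iff] at he
      simp only [Sym2.eq_iff] at he
      rcases he with ⟨j, hj, ⟨rfl, -⟩ | ⟨rfl, -⟩⟩ | ⟨j, h1, hj, ⟨rfl, -⟩ | ⟨rfl, -⟩⟩
      · exact aligned_comb hf hc hβ (by omega)
      · exact aligned_comb hf hc hβ (by omega)
      · exact aligned_comb hf hc hβ (by omega)
      · exact aligned_framePt hf (hc.tip_mem h1 hj) (hc.tip_mem h1 hj)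
    · exact (hXn q q' he).1
  · rcases he with he | he
    · rw [mem_combEdges_iff] at he
      simp only [Sym2.eq_iff] at he
      rcases he with ⟨j, hj, ⟨rfl, -⟩ | ⟨rfl, -⟩⟩ | ⟨j, h1, hj, ⟨rfl, -⟩ | ⟨rfl, -⟩⟩
      · exact hgood _ (by omega) hq
      · exact hgood _ (by omega) hq
      · exact hgood _ (by omega) hq
      · exact absurd (hc.tip_mem h1 hj) hq
    · exact (hXn q q' he).2.1 hq
  · rcases he with he | he
    · rw [mem_combEdges_iff] at he
      simp only [Sym2.eq_iff] at he
      rcases he with ⟨j, hj, ⟨rfl, rfl⟩ | ⟨rfl, rfl⟩⟩ | ⟨j, h1, hj, ⟨rfl, rfl⟩ | ⟨rfl, rfl⟩⟩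
      · exact halt j hj hq hq'
      · exact (halt j hj hq' hq).symm
      · exact absurd (hc.tip_mem h1 hj) hq'
      · exact absurd (hc.tip_mem h1 hj) hq
    · exact (hXn q q' he).2.2 hq hq'

/-- A comb has no edges at its starting point apart from the one on the segment. -/
theorem eq_of_mem_combEdges (hf : IsAxisFrame u w) (hc : IsAlternatingComb P z u w k t h)
    {α β : ℝ} (hm : s(framePt z u w 0 0, framePt z u w α β) ∈ combEdges z u w k t h) :
    0 < α ∧ β = 0 := by
  rw [mem_combEdges_iff] at hm
  simp only [Sym2.eq_iff, framePt_inj hf] at hm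
  rcases hm with ⟨j, hj, h | h⟩ | ⟨j, h1, hj, h | h⟩
  · rw [h.2.1]
    exact ⟨hc.pos (by omega) (by omega), h.2.2⟩
  · exact absurd h.1.1 (hc.pos (by omega) (by omega)).ne
  · exact absurd h.1.1 (hc.pos h1 (by omega)).ne
  · exact absurd h.1.1 (hc.pos h1 (by omega)).ne

end Comb

theorem framePt_zero (z u w : Pt) : framePt z u w 0 0 = z := by simp [framePt]

theorem IsSegmentType.isLocallyAlternating {P : Set Pt} {E : Set (Sym2 Pt)}
    (h : IsSegmentType P E) : IsLocallyAlternating P E := by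
  obtain ⟨z, u, w, k, t, h, hf, hc, hz, rfl⟩ := h
  rw [← Set.union_empty (combEdges z u w k t h)]
  exact isLocallyAlternating_comb hf hc (by simp) (β := 0) (by rwa [framePt_zero])
    (fun hn => absurd hz hn) (by simp)

theorem IsCornerType.isLocallyAlternating {P : Set Pt} {E : Set (Sym2 Pt)}
    (h : IsCornerType P E) : IsLocallyAlternating P E := by
  obtain ⟨z, u, w, k, t, h, b, hf, hc, hb, hbP, -, rfl⟩ := h
  have hz := framePt_zero z u w
  have hbf : z + b • w = framePt z u w 0 b := by simp [framePt]
  rw [hbf] at hbP ⊢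
  have hXm : ∀ α β α' β', s(framePt z u w α β, framePt z u w α' β') ∈
      ({s(z, framePt z u w 0 b)} : Set (Sym2 Pt)) →
      (α = 0 ∧ β = 0 ∧ α' = 0 ∧ β' = b) ∨ (α = 0 ∧ β = b ∧ α' = 0 ∧ β' = 0) := by
    intro α β α' β' hm
    have hX' : ({s(z, framePt z u w 0 b)} : Set (Sym2 Pt)) =
      {s(framePt z u w 0 0, framePt z u w 0 b)} := by rw [hz]
    rw [hX'] at hm
    simp only [Set.mem_singleton_iff, Sym2.eq_iff, framePt_inj hf] at hm
    tauto
  have hX : ∀ α β α' β', s(framePt z u w α β, framePt z u w α' β') ∈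
      ({s(z, framePt z u w 0 b)} : Set (Sym2 Pt)) → α ≤ 0 ∧ α' ≤ 0 := by
    intro α β α' β' hm
    rcases hXm _ _ _ _ hm with h | h
    · exact ⟨h.1.le, h.2.2.1.le⟩
    · exact ⟨h.1.le, h.2.2.1.le⟩
  set E := combEdges z u w k t h ∪ {s(z, framePt z u w 0 b)} with hE
  have hadd : z + b • w = framePt z u w 0 b := hbf
  have k1 : HasEdge E u z := by
    have := hasEdge_comb_succ (X := {s(z, framePt z u w 0 b)}) hc (Nat.zero_le k)
    rwa [hc.start, hz] at this
  have k2 : HasEdge E w z := ⟨b, hb, Or.inr (by rw [hadd]; rfl)⟩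
  have k3 : ¬HasEdge E (-u) z := by
    rintro ⟨c, hc0, hm⟩
    rw [← hz, framePt_sub_left] at hm
    rcases hm with hm | hm
    · have := (eq_of_mem_combEdges hf hc hm).1
      linarith
    · rcases hXm _ _ _ _ hm with h | h <;> linarith [h.1, h.2.2.1]
  have k4 : ¬HasEdge E (-w) z := by
    rintro ⟨c, hc0, hm⟩
    rw [← hz, framePt_sub_right] at hm
    rcases hm with hm | hm
    · have := (eq_of_mem_combEdges hf hc hm).1
      linarith
    · rcases hXm _ _ _ _ hm with h | h <;> linarith [h.2.1, h.2.2.2]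
  have k5 : GoodNode P E z := goodNode_of_corner hf k1 k3 k2 k4 (reflTransGen_step_comb hc)
    ⟨_, hbP, .single ⟨b, hb, hadd.symm, Or.inr rfl⟩⟩
  refine isLocallyAlternating_comb hf hc hX hbP (fun _ => ⟨k5, k2, k4⟩) ?_
  intro q q' hm
  rw [Set.mem_singleton_iff, Sym2.eq_iff] at hm
  rcases hm with ⟨rfl, rfl⟩ | ⟨rfl, rfl⟩
  · refine ⟨?_, fun _ => k5, fun _ h => absurd hbP h⟩
    have := aligned_framePt hf hbP hc.end_mem
    rwa [hz] at this
  · exact ⟨aligned_framePt hf hbP hbP, fun h => absurd hbP h, fun h => absurd hbP h⟩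

theorem IsCornerTypeWithEdge.isLocallyAlternating {P : Set Pt} {E : Set (Sym2 Pt)}
    (h : IsCornerTypeWithEdge P E) : IsLocallyAlternating P E := by
  obtain ⟨z, u, w, k, t, h, b, r, q, hf, hc, hr, hrb, hq, hbP, hqP, -, rfl⟩ := h
  have hz := framePt_zero z u w
  have hbf : z + b • w = framePt z u w 0 b := by simp [framePt]
  have hrf : z + r • w = framePt z u w 0 r := by simp [framePt]
  have hqf : framePt z u w 0 r - q • u = framePt z u w (-q) r := by simp only [framePt]; module
  rw [hbf] at hbP ⊢
  rw [hrf, hqf] at hqP ⊢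
  set X : Set (Sym2 Pt) := {s(z, framePt z u w 0 r), s(framePt z u w 0 r, framePt z u w 0 b),
    s(framePt z u w 0 r, framePt z u w (-q) r)} with hXdef
  have hXdef' : X = {s(framePt z u w 0 0, framePt z u w 0 r),
    s(framePt z u w 0 r, framePt z u w 0 b),
    s(framePt z u w 0 r, framePt z u w (-q) r)} := by rw [hz]
  have hXm : ∀ α β α' β', s(framePt z u w α β, framePt z u w α' β') ∈ X →
      α ≤ 0 ∧ α' ≤ 0 ∧ (β = 0 → α = 0 → α' = 0 ∧ β' = r) := by
    intro α β α' β' hm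
    rw [hXdef'] at hm
    simp only [Set.mem_insert_iff, Set.mem_singleton_iff, Sym2.eq_iff, framePt_inj hf] at hm
    rcases hm with (⟨⟨rfl, rfl⟩, rfl, rfl⟩ | ⟨⟨rfl, rfl⟩, rfl, rfl⟩) |
      (⟨⟨rfl, rfl⟩, rfl, rfl⟩ | ⟨⟨rfl, rfl⟩, rfl, rfl⟩) |
      (⟨⟨rfl, rfl⟩, rfl, rfl⟩ | ⟨⟨rfl, rfl⟩, rfl, rfl⟩) <;>
    refine ⟨?_, ?_, fun h1 h2 => ?_⟩ <;>
    first
      | linarith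
      | (constructor <;> linarith)
  have hX : ∀ α β α' β', s(framePt z u w α β, framePt z u w α' β') ∈ X → α ≤ 0 ∧ α' ≤ 0 :=
    fun α β α' β' hm => ⟨(hXm _ _ _ _ hm).1, (hXm _ _ _ _ hm).2.1⟩
  set E := combEdges z u w k t h ∪ X with hE
  have m1 : s(z, framePt z u w 0 r) ∈ E := Or.inr (by simp [hXdef])
  have m2 : s(framePt z u w 0 r, framePt z u w 0 b) ∈ E := Or.inr (by simp [hXdef])
  have m3 : s(framePt z u w 0 r, framePt z u w (-q) r) ∈ E := Or.inr (by simp [hXdef])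
  have a2 : framePt z u w 0 r + (b - r) • w = framePt z u w 0 b := by
    rw [framePt_add_right, add_sub_cancel]
  have a3 : framePt z u w 0 r + q • (-u) = framePt z u w (-q) r := by
    rw [framePt_sub_left, zero_sub]
  have a4 : framePt z u w 0 r + r • (-w) = z := by
    rw [framePt_sub_right, sub_self, hz]
  have k1 : HasEdge E u z := by
    have := hasEdge_comb_succ (X := X) hc (Nat.zero_le k)
    rwa [hc.start, hz] at this
  have k2 : HasEdge E w z := ⟨r, hr, by rwa [hrf]⟩
  have k3 : ¬HasEdge E (-u) z := by
    rintro ⟨c, hc0, hm⟩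
    rw [← hz, framePt_sub_left] at hm
    rcases hm with hm | hm
    · have := (eq_of_mem_combEdges hf hc hm).1
      linarith
    · have := (hXm _ _ _ _ hm).2.2 rfl rfl
      linarith [this.1]
  have k4 : ¬HasEdge E (-w) z := by
    rintro ⟨c, hc0, hm⟩
    rw [← hz, framePt_sub_right] at hm
    rcases hm with hm | hm
    · have := (eq_of_mem_combEdges hf hc hm).1
      linarith
    · have := (hXm _ _ _ _ hm).2.2 rfl rfl
      linarith [this.2]
  have k5 : GoodNode P E z := goodNode_of_corner hf k1 k3 k2 k4 (reflTransGen_step_comb hc)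
    ⟨_, hbP, .head ⟨r, hr, hrf.symm, m1⟩ (.single ⟨b - r, sub_pos.2 hrb, a2.symm, m2⟩)⟩
  have r1 : HasEdge E w (framePt z u w 0 r) := ⟨b - r, sub_pos.2 hrb, by rwa [a2]⟩
  have r2 : HasEdge E (-w) (framePt z u w 0 r) := ⟨r, hr, by rwa [a4, Sym2.eq_swap]⟩
  have r3 : HasEdge E (-u) (framePt z u w 0 r) := ⟨q, hq, by rwa [a3]⟩
  have r4 : ¬HasEdge E u (framePt z u w 0 r) := by
    rintro ⟨c, hc0, hm⟩
    rw [framePt_add_left] at hm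
    rcases hm with hm | hm
    · rw [mem_combEdges_iff] at hm
      simp only [Sym2.eq_iff, framePt_inj hf] at hm
      rcases hm with ⟨j, hj, h | h⟩ | ⟨j, h1, hj, h | h⟩
      · exact hr.ne' h.1.2
      · exact hr.ne' h.1.2
      · exact hr.ne' h.1.2
      · exact absurd h.1.1 (hc.pos h1 (by omega)).ne
    · have := (hXm _ _ _ _ hm).2.1
      linarith
  have r5 : GoodNode P E (framePt z u w 0 r) := goodNode_of_tee hf.symm.neg_right r1 r2 r3
    ⟨_, hqP, .single ⟨q, hq, a3.symm, m3⟩⟩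
  have hA : Alternate E z (framePt z u w 0 r) := ⟨w, u, hf.symm, ⟨r, hrf.symm⟩, k1, k3, r3, r4⟩
  have hAz : Aligned P z := by
    have := aligned_framePt hf hbP hc.end_mem
    rwa [hz] at this
  have hAr : Aligned P (framePt z u w 0 r) := aligned_framePt hf hbP hqP
  have hAb : Aligned P (framePt z u w 0 b) := aligned_framePt hf hbP hbP
  have hAq : Aligned P (framePt z u w (-q) r) := aligned_framePt hf hqP hqP
  refine isLocallyAlternating_comb hf hc hX hbP (fun _ => ⟨k5, k2, k4⟩) ?_
  intro c c' hm
  simp only [hXdef, Set.mem_insert_iff, Set.mem_singleton_iff, Sym2.eq_iff] at hm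
  rcases hm with (⟨rfl, rfl⟩ | ⟨rfl, rfl⟩) | (⟨rfl, rfl⟩ | ⟨rfl, rfl⟩) | (⟨rfl, rfl⟩ | ⟨rfl, rfl⟩)
  · exact ⟨hAz, fun _ => k5, fun _ _ => hA⟩
  · exact ⟨hAr, fun _ => r5, fun _ _ => hA.symm⟩
  · exact ⟨hAr, fun _ => r5, fun _ h => absurd hbP h⟩
  · exact ⟨hAb, fun h => absurd hbP h, fun h => absurd hbP h⟩
  · exact ⟨hAr, fun _ => r5, fun _ h => absurd hqP h⟩
  · exact ⟨hAq, fun h => absurd hqP h, fun h => absurd hqP h⟩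

/-! ### Counting the crossings of a Hwang tree -/

theorem HasEdge.mono {E E' : Set (Sym2 Pt)} (h : E ⊆ E') {d q : Pt} (hq : HasEdge E d q) :
    HasEdge E' d q := by
  obtain ⟨c, hc, hm⟩ := hq
  exact ⟨c, hc, h hm⟩

theorem LeadsTo.mono {P : Set Pt} {E E' : Set (Sym2 Pt)} (h : E ⊆ E') {d q : Pt}
    (hq : LeadsTo P E d q) : LeadsTo P E' d q := by
  obtain ⟨p, hp, hr⟩ := hq
  exact ⟨p, hp, Relation.ReflTransGen.mono (fun a b ⟨c, hc, hab, hm⟩ => ⟨c, hc, hab, h hm⟩) _ _ hr⟩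

/-- Every edge lies in a full component of one of the four types, and the conditions only concern
edges at non-terminal nodes, which all belong to that component. -/
theorem IsHwangTree.isLocallyAlternating {P : Set Pt} {T : RectTree} (hT : IsHwangTree P T) :
    IsLocallyAlternating P T.graph.edgeSet := by
  have key : ∀ q q', s(q, q') ∈ T.graph.edgeSet → ∃ C : T.graph.Subgraph,
      IsFullComponent P T C ∧ C.Adj q q' ∧ IsLocallyAlternating P C.edgeSet := by
    intro q q' h
    obtain ⟨C, hC, hadj⟩ := exists_isFullComponent_of_adj P T h
    refine ⟨C, hC, hadj, ?_⟩
    rcases hT.2.2 C hC with h | h | h | h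
    exacts [h.isLocallyAlternating, h.isLocallyAlternating, h.isLocallyAlternating,
      h.isLocallyAlternating]
  have hiff : ∀ C : T.graph.Subgraph, IsFullComponent P T C → ∀ q ∈ C.verts, q ∉ P → ∀ d,
      (HasEdge T.graph.edgeSet d q ↔ HasEdge C.edgeSet d q) := fun C hC q hq hqP d =>
    ⟨fun ⟨c, hc, hm⟩ => ⟨c, hc, hC.adj_of_notMem hq hqP hm⟩, .mono C.edgeSet_subset⟩
  refine ⟨fun q q' h => ?_, fun q q' h hq => ?_, fun q q' h hq hq' => ?_⟩
  · obtain ⟨C, -, hadj, hl⟩ := key q q' h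
    exact hl.aligned q q' hadj
  · obtain ⟨C, hC, hadj, hl⟩ := key q q' h
    have hi := hiff C hC q hadj.fst_mem hq
    intro u w huw hw hw'
    rw [hi] at hw hw'
    obtain ⟨h1, h2⟩ := hl.good q q' hadj hq u w huw hw hw'
    exact ⟨h1.mono C.edgeSet_subset, by rwa [hi, hi]⟩
  · obtain ⟨C, hC, hadj, hl⟩ := key q q' h
    obtain ⟨u, w, h1, h2, h3, h4, h5, h6⟩ := hl.alternate q q' hadj hq hq'
    have hi := hiff C hC q hadj.fst_mem hq
    have hi' := hiff C hC q' hadj.snd_mem hq'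
    exact ⟨u, w, h1, h2, by rwa [hi], by rwa [hi], by rwa [hi'], by rwa [hi']⟩

namespace RectTree

variable (T : RectTree)

/-- The end of the shorter edge would lie on the longer one without being its endpoint. All
injectivity arguments in the counting below rest on this. -/
theorem eq_of_adj_of_adj {q d : Pt} {c c' : ℝ} (hc : 0 < c) (hc' : 0 < c')
    (h : T.graph.Adj q (q + c • d)) (h' : T.graph.Adj q (q + c' • d)) :
    q + c • d = q + c' • d := by
  wlog hle : c ≤ c' generalizing c c'
  · exact (this hc' hc h' h (le_of_not_ge hle)).symm
  by_contra hne
  have hE : s(q, q + c • d) ≠ s(q, q + c' • d) := by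
    intro he
    rw [Sym2.congr_right] at he
    exact hne he
  have hm := T.embedded _ h _ h' hE (q + c • d) (right_mem_segment ℝ _ _) (by
    rw [edgeSegment_mk]
    refine ⟨1 - c / c', c / c', sub_nonneg.2 ((div_le_one hc').2 hle), by positivity, by ring, ?_⟩
    have : c / c' * c' = c := div_mul_cancel₀ _ hc'.ne'
    rw [smul_add, smul_smul, this]
    module)
  rcases Sym2.mem_iff.1 hm.2 with h1 | h1
  · exact h.ne' h1
  · exact hne h1

theorem finite_support : T.graph.support.Finite := by
  refine (T.finite_edges.biUnion (t := fun e => {q | q ∈ e}) fun e _ => ?_).subset ?_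
  · induction e with
    | _ a b => exact (Set.toFinite {a, b}).subset fun q hq => by simpa using hq
  · rintro q ⟨q', h⟩
    exact Set.mem_biUnion (x := s(q, q')) h (by simp)

theorem finite_adj : {e : Pt × Pt | T.graph.Adj e.1 e.2}.Finite :=
  (T.finite_support.prod T.finite_support).subset fun e h => ⟨⟨e.2, h⟩, ⟨e.1, h.symm⟩⟩

theorem snd_eq_of_adj {a b : Pt} (h : T.graph.Adj a b) (hlt : a.1 < b.1) : a.2 = b.2 :=
  (T.axis_parallel a b h).resolve_left hlt.ne

theorem hasEdge_left {a b : Pt} (h : T.graph.Adj a b) (hlt : a.1 < b.1) :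
    HasEdge T.graph.edgeSet (-1, 0) b := by
  refine ⟨b.1 - a.1, sub_pos.2 hlt, ?_⟩
  have : b + (b.1 - a.1) • ((-1, 0) : Pt) = a := by
    ext <;> simp [T.snd_eq_of_adj h hlt]
  rw [this]
  exact h.symm

/-- The edges that meet the vertical line at `s`, oriented from left to right; those that only end
there are not counted. -/
def cut (s : ℝ) : Set (Pt × Pt) := {e | T.graph.Adj e.1 e.2 ∧ e.1.1 ≤ s ∧ s < e.2.1}

theorem finite_cut (s : ℝ) : (T.cut s).Finite := T.finite_adj.subset fun _ h => h.1

end RectTree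

section Hwang

variable {P : Set Pt} {T : RectTree}

/-- Send `q` to its upper neighbour. If that is not a terminal, alternation along the vertical edge
gives it an edge to the right and none to the left. The map is injective because a node has only one
downward edge. -/
theorem ncard_upward_le (hl : IsLocallyAlternating P T.graph.edgeSet) (s x : ℝ)
    (hP : P.Finite) :
    {q | (s < q.1 ∧ q.1 ≤ x) ∧ q ∉ P ∧ HasEdge T.graph.edgeSet (-1, 0) q ∧
      ¬HasEdge T.graph.edgeSet (1, 0) q ∧ HasEdge T.graph.edgeSet (0, 1) q}.ncard ≤
    {q | (s < q.1 ∧ q.1 ≤ x) ∧ HasEdge T.graph.edgeSet (1, 0) q ∧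
      ¬HasEdge T.graph.edgeSet (-1, 0) q}.ncard + {p | p ∈ P ∧ s < p.1 ∧ p.1 ≤ x}.ncard := by
  refine le_trans ?_ (Set.ncard_union_le _ _)
  have hex : ∀ q ∈ {q | (s < q.1 ∧ q.1 ≤ x) ∧ q ∉ P ∧ HasEdge T.graph.edgeSet (-1, 0) q ∧
      ¬HasEdge T.graph.edgeSet (1, 0) q ∧ HasEdge T.graph.edgeSet (0, 1) q},
      ∃ q', ∃ c : ℝ, 0 < c ∧ q' = q + c • ((0, 1) : Pt) ∧ T.graph.Adj q q' :=
    fun q ⟨_, _, _, _, c, hc, h⟩ => ⟨_, c, hc, rfl, h⟩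
  choose! f hf using hex
  refine Set.ncard_le_ncard_of_injOn f ?_ ?_ ?_
  · rintro q hq
    obtain ⟨c, hc, hfq, hadj⟩ := hf q hq
    have hx : (f q).1 = q.1 := by rw [hfq]; simp
    have hy : q.2 < (f q).2 := by rw [hfq]; simpa
    by_cases hfP : f q ∈ P
    · exact Or.inr ⟨hfP, by rw [hx]; exact hq.1⟩
    left
    refine ⟨by rw [hx]; exact hq.1, ?_⟩
    obtain ⟨u, w, hfr, ⟨c', hc'⟩, h1, h2, h3, h4⟩ := hl.alternate q (f q) hadj hq.2.1 hfP
    rcases hfr with ⟨rfl | rfl, -⟩ | ⟨-, rfl | rfl⟩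
    · rw [hc'] at hy; simp at hy
    · rw [hc'] at hy; simp at hy
    · exact absurd h1 hq.2.2.2.1
    · exact ⟨by simpa using h3, h4⟩
  · intro q hq r hr hqr
    obtain ⟨c, hc, hfq, hadj⟩ := hf q hq
    obtain ⟨c', hc', hfr, hadj'⟩ := hf r hr
    rw [← hqr] at hfr hadj'
    have e1 : f q + c • ((0, -1) : Pt) = q := by rw [hfq]; ext <;> simp
    have e2 : f q + c' • ((0, -1) : Pt) = r := by rw [hfr]; ext <;> simp
    have := T.eq_of_adj_of_adj hc hc' (by rw [e1]; exact hadj.symm) (by rw [e2]; exact hadj'.symm)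
    rwa [e1, e2] at this
  · refine Set.Finite.union (T.finite_support.subset ?_) (hP.subset fun _ h => h.1)
    rintro q ⟨-, ⟨c, -, h⟩, -⟩
    exact ⟨_, h⟩

/-- The edge from the left is unopposed, so there is a perpendicular edge; it goes down, is itself
unopposed, and leads to a terminal straight below. That terminal determines `q`: walk up from it as
far as possible. -/
theorem ncard_topCorner_le (hl : IsLocallyAlternating P T.graph.edgeSet) (s x : ℝ)
    (hP : P.Finite) :
    {q | (s < q.1 ∧ q.1 ≤ x) ∧ q ∉ P ∧ HasEdge T.graph.edgeSet (-1, 0) q ∧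
      ¬HasEdge T.graph.edgeSet (1, 0) q ∧ ¬HasEdge T.graph.edgeSet (0, 1) q}.ncard ≤
    {p | p ∈ P ∧ s < p.1 ∧ p.1 ≤ x}.ncard := by
  have hex : ∀ q ∈ {q | (s < q.1 ∧ q.1 ≤ x) ∧ q ∉ P ∧ HasEdge T.graph.edgeSet (-1, 0) q ∧
      ¬HasEdge T.graph.edgeSet (1, 0) q ∧ ¬HasEdge T.graph.edgeSet (0, 1) q},
      LeadsTo P T.graph.edgeSet (0, -1) q := by
    rintro q ⟨-, hqP, h1, h2, h3⟩
    obtain ⟨c, hc, hm⟩ := id h1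
    have hg := hl.good _ _ hm hqP
    have h4 := (hg (0, 1) (-1, 0) (by simp [IsAxisFrame]) h1 (by simpa using h2)).2.resolve_left h3
    exact (hg (1, 0) (0, -1) (by simp [IsAxisFrame]) (by simpa using h4) (by simpa using h3)).1
  choose! f hfP hf using hex
  refine Set.ncard_le_ncard_of_injOn f ?_ ?_ (hP.subset fun _ h => h.1)
  · intro q hq
    have hx : ∀ a b, Relation.ReflTransGen (Step T.graph.edgeSet (0, -1)) a b → b.1 = a.1 := by
      intro a b h
      induction h with
      | refl => rfl
      | tail _ h ih =>
        obtain ⟨c, -, rfl, -⟩ := h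
        simpa using ih
    exact ⟨hfP q hq, by rw [hx _ _ (hf q hq)]; exact hq.1⟩
  · intro q hq r hr hqr
    -- Walking upwards is deterministic, so two upward walks from the same terminal are comparable,
    -- and both end at nodes without an upward edge.
    have hu : Relator.RightUnique (Function.swap (Step T.graph.edgeSet (0, -1))) := by
      rintro a b d ⟨c, hc, h1, h2⟩ ⟨c', hc', h3, h4⟩
      have e1 : a + c • ((0, 1) : Pt) = b := by rw [h1]; ext <;> simp
      have e2 : a + c' • ((0, 1) : Pt) = d := by rw [h3]; ext <;> simp
      rw [← e1, ← e2]
      refine T.eq_of_adj_of_adj hc hc' ?_ ?_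
      · rw [e1]; exact SimpleGraph.Adj.symm h2
      · rw [e2]; exact SimpleGraph.Adj.symm h4
    have htop : ∀ a b, ¬HasEdge T.graph.edgeSet (0, 1) a →
        Relation.ReflTransGen (Function.swap (Step T.graph.edgeSet (0, -1))) a b → a = b := by
      intro a b ha h
      rcases Relation.ReflTransGen.cases_head h with h | ⟨d, ⟨c, hc, h1, h2⟩, -⟩
      · exact h
      · refine absurd ⟨c, hc, ?_⟩ ha
        have e1 : a + c • ((0, 1) : Pt) = d := by rw [h1]; ext <;> simp
        rw [e1]
        exact SimpleGraph.Adj.symm h2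
    have h1 := Relation.reflTransGen_swap.2 (hf q hq)
    have h2 := Relation.reflTransGen_swap.2 (hf r hr)
    rw [← hqr] at h2
    rcases Relation.ReflTransGen.total_of_right_unique hu h1 h2 with h | h
    · exact htop _ _ hq.2.2.2.2 h
    · exact (htop _ _ hr.2.2.2.2 h).symm

theorem ncard_leftNodes_le (hl : IsLocallyAlternating P T.graph.edgeSet) (s x : ℝ)
    (hP : P.Finite) :
    {q | (s < q.1 ∧ q.1 ≤ x) ∧ HasEdge T.graph.edgeSet (-1, 0) q}.ncard ≤
    {q | (s < q.1 ∧ q.1 ≤ x) ∧ HasEdge T.graph.edgeSet (1, 0) q}.ncard +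
      3 * {p | p ∈ P ∧ s < p.1 ∧ p.1 ≤ x}.ncard := by
  set E := T.graph.edgeSet
  set L := {q : Pt | (s < q.1 ∧ q.1 ≤ x) ∧ HasEdge E (-1, 0) q} with hL
  set R := {q : Pt | (s < q.1 ∧ q.1 ≤ x) ∧ HasEdge E (1, 0) q} with hR
  set D := {p : Pt | p ∈ P ∧ s < p.1 ∧ p.1 ≤ x} with hD
  have hfin : ∀ d : Pt, {q : Pt | (s < q.1 ∧ q.1 ≤ x) ∧ HasEdge E d q}.Finite := fun d =>
    T.finite_support.subset fun q ⟨_, c, _, h⟩ => ⟨_, h⟩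
  have hLfin : L.Finite := hfin _
  have hRfin : R.Finite := hfin _
  have h1 := ncard_upward_le hl s x hP
  have h2 := ncard_topCorner_le hl s x hP
  have hRL : R \ L = {q | (s < q.1 ∧ q.1 ≤ x) ∧ HasEdge E (1, 0) q ∧ ¬HasEdge E (-1, 0) q} := by
    ext q
    simp only [hL, hR, Set.mem_sdiff, Set.mem_ofPred_eq]
    tauto
  set A := {q : Pt | (s < q.1 ∧ q.1 ≤ x) ∧ q ∉ P ∧ HasEdge E (-1, 0) q ∧
      ¬HasEdge E (1, 0) q ∧ HasEdge E (0, 1) q}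
  set B := {q : Pt | (s < q.1 ∧ q.1 ≤ x) ∧ q ∉ P ∧ HasEdge E (-1, 0) q ∧
      ¬HasEdge E (1, 0) q ∧ ¬HasEdge E (0, 1) q}
  rw [← hRL, ← hD] at h1
  rw [← hD] at h2
  -- The three terms of the bound: `D` itself, `A` with at most `(R \ L).ncard + D.ncard` elements,
  -- and `B` with at most `D.ncard`. The surplus `R \ L` cancels in the final count.
  have hsub : L \ R ⊆ D ∪ (A ∪ B) := by
    rintro q ⟨⟨hq, hq1⟩, hq2⟩
    have hq2 : ¬HasEdge E (1, 0) q := fun h => hq2 ⟨hq, h⟩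
    by_cases hqP : q ∈ P
    · exact Or.inl ⟨hqP, hq⟩
    by_cases hup : HasEdge E (0, 1) q
    · exact Or.inr (Or.inl ⟨hq, hqP, hq1, hq2, hup⟩)
    · exact Or.inr (Or.inr ⟨hq, hqP, hq1, hq2, hup⟩)
  have hfin' : (D ∪ (A ∪ B)).Finite :=
    (hP.subset fun _ h => h.1).union
      ((hLfin.subset fun q h => ⟨h.1, h.2.2.1⟩).union (hLfin.subset fun q h => ⟨h.1, h.2.2.1⟩))
  have h3 := Set.ncard_le_ncard hsub hfin'
  have h4 := Set.ncard_union_le D (A ∪ B)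
  have h5 := Set.ncard_union_le A B
  have h6 := Set.ncard_inter_add_ncard_sdiff_eq_ncard L R hLfin
  have h7 := Set.ncard_inter_add_ncard_sdiff_eq_ncard R L hRfin
  rw [Set.inter_comm] at h7
  omega

/-- Over a vertical strip, the number of horizontal edges decreases by at most three for every
terminal in the strip. -/
theorem ncard_cut_le (hl : IsLocallyAlternating P T.graph.edgeSet) {s x : ℝ} (hsx : s ≤ x)
    (hP : P.Finite) :
    (T.cut s).ncard ≤ (T.cut x).ncard + 3 * {p | p ∈ P ∧ s < p.1 ∧ p.1 ≤ x}.ncard := by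
  set L := {e : Pt × Pt | T.graph.Adj e.1 e.2 ∧ e.1.1 < e.2.1 ∧ s < e.2.1 ∧ e.2.1 ≤ x}
  set R := {e : Pt × Pt | T.graph.Adj e.1 e.2 ∧ e.1.1 < e.2.1 ∧ s < e.1.1 ∧ e.1.1 ≤ x}
  have hLfin : L.Finite := T.finite_adj.subset fun _ h => h.1
  have hRfin : R.Finite := T.finite_adj.subset fun _ h => h.1
  -- Between `s` and `x`, the edges of `R` start and those of `L` end.
  have hunion : T.cut s ∪ R = T.cut x ∪ L := by
    ext e
    simp only [L, R, RectTree.cut, Set.mem_union, Set.mem_ofPred_eq]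
    constructor
    · rintro (⟨h1, h2, h3⟩ | ⟨h1, h2, h3, h4⟩)
      · rcases lt_or_ge x e.2.1 with h | h
        · exact Or.inl ⟨h1, by linarith, h⟩
        · exact Or.inr ⟨h1, by linarith, h3, h⟩
      · rcases lt_or_ge x e.2.1 with h | h
        · exact Or.inl ⟨h1, h4, h⟩
        · exact Or.inr ⟨h1, h2, by linarith, h⟩
    · rintro (⟨h1, h2, h3⟩ | ⟨h1, h2, h3, h4⟩)
      · rcases lt_or_ge s e.1.1 with h | h
        · exact Or.inr ⟨h1, by linarith, h, h2⟩
        · exact Or.inl ⟨h1, h, by linarith⟩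
      · rcases lt_or_ge s e.1.1 with h | h
        · exact Or.inr ⟨h1, h2, h, by linarith⟩
        · exact Or.inl ⟨h1, h, h3⟩
  have hd1 : Disjoint (T.cut s) R :=
    Set.disjoint_left.2 fun e h1 h2 => not_lt.2 h1.2.1 h2.2.2.1
  have hd2 : Disjoint (T.cut x) L :=
    Set.disjoint_left.2 fun e h1 h2 => not_lt.2 h2.2.2.2 h1.2.2
  have h1 := Set.ncard_union_eq hd1 (T.finite_cut s) hRfin
  have h2 := Set.ncard_union_eq hd2 (T.finite_cut x) hLfin
  rw [hunion] at h1
  have h3 := ncard_leftNodes_le hl s x hP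
  have h4 : L.ncard ≤ {q : Pt | (s < q.1 ∧ q.1 ≤ x) ∧
      HasEdge T.graph.edgeSet (-1, 0) q}.ncard := by
    refine Set.ncard_le_ncard_of_injOn Prod.snd ?_ ?_ ?_
    · exact fun e he => ⟨he.2.2, T.hasEdge_left he.1 he.2.1⟩
    · rintro ⟨a, b⟩ ⟨he1, he2, -⟩ ⟨a', b'⟩ ⟨he1', he2', -⟩ hbb'
      simp only at hbb' he1 he2 he1' he2'
      subst hbb'
      have e1 : b + (b.1 - a.1) • ((-1, 0) : Pt) = a := by
        ext <;> simp [T.snd_eq_of_adj he1 he2]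
      have e2 : b + (b.1 - a'.1) • ((-1, 0) : Pt) = a' := by
        ext <;> simp [T.snd_eq_of_adj he1' he2']
      have := T.eq_of_adj_of_adj (d := (-1, 0)) (sub_pos.2 he2) (sub_pos.2 he2')
        (by rw [e1]; exact he1.symm) (by rw [e2]; exact he1'.symm)
      rw [e1, e2] at this
      rw [this]
    · exact T.finite_support.subset fun q ⟨_, c, _, h⟩ => ⟨_, h⟩
  have h5 : {q : Pt | (s < q.1 ∧ q.1 ≤ x) ∧
      HasEdge T.graph.edgeSet (1, 0) q}.ncard ≤ R.ncard := by
    have hex : ∀ q ∈ {q : Pt | (s < q.1 ∧ q.1 ≤ x) ∧ HasEdge T.graph.edgeSet (1, 0) q},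
        ∃ q', T.graph.Adj q q' ∧ q.1 < q'.1 := by
      rintro q ⟨-, c, hc, h⟩
      exact ⟨_, h, by simpa using hc⟩
    choose! f hf using hex
    refine Set.ncard_le_ncard_of_injOn (fun q => (q, f q)) ?_ ?_ hRfin
    · exact fun q hq => ⟨(hf q hq).1, (hf q hq).2, hq.1⟩
    · intro q _ r _ h
      exact congrArg Prod.fst h
  omega

/-- A vertical line that contains no terminal is crossed by horizontal edges only. -/
theorem crossings_subset (hl : IsLocallyAlternating P T.graph.edgeSet) {s : ℝ}
    (hs : ∀ p ∈ P, p.1 ≠ s) : T.crossings s ⊆ (fun e : Pt × Pt => (s, e.1.2)) '' T.cut s := by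
  rintro ⟨x, y⟩ ⟨⟨e, he, hq⟩, hx⟩
  simp only at hx
  subst hx
  -- By alignment no node lies on the line, so no vertical edge does, and horizontal edges are met
  -- in their interior.
  have hne : ∀ a b, T.graph.Adj a b → a.1 ≠ x := by
    intro a b h hax
    obtain ⟨⟨p, hp, hpa⟩, -⟩ := hl.aligned a b h
    exact hs p hp (hpa.trans hax)
  induction e with
  | _ a b =>
    wlog hab : a.1 ≤ b.1 generalizing a b
    · rw [Sym2.eq_swap] at he hq
      exact this b a he hq (le_of_not_ge hab)
    have hadj : T.graph.Adj a b := he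
    rw [edgeSegment_mk] at hq
    rcases hab.eq_or_lt with h | h
    · rw [mem_segment_of_fst_eq h] at hq
      exact absurd hq.1.symm (hne a b hadj)
    · rw [mem_segment_of_snd_eq (T.snd_eq_of_adj hadj h), Set.uIcc_of_le hab] at hq
      refine ⟨(a, b), ⟨hadj, hq.2.1, lt_of_le_of_ne hq.2.2 (hne b a hadj.symm).symm⟩, ?_⟩
      simp only [Prod.mk.injEq, true_and]
      exact hq.1.symm

end Hwang

/-! ### Replacing the part of a tree in a vertical strip -/

/-- The projection of `x` to the interval `[a, b]`. -/
noncomputable def clamp (a b x : ℝ) : ℝ := max a (min x b)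

/-- The horizontal length of an edge between the vertical lines at `a` and at `b`. -/
noncomputable def windowLength (a b : ℝ) : Sym2 Pt → ℝ :=
  Sym2.lift ⟨fun u v => |clamp a b u.1 - clamp a b v.1|, fun _ _ => abs_sub_comm _ _⟩

@[simp] theorem windowLength_mk (a b : ℝ) (u v : Pt) :
    windowLength a b s(u, v) = |clamp a b u.1 - clamp a b v.1| := rfl

theorem windowLength_nonneg (a b : ℝ) (e : Sym2 Pt) : 0 ≤ windowLength a b e := by
  induction e with
  | _ u v => exact abs_nonneg _

theorem abs_sub_eq_window {a b : ℝ} (hab : a ≤ b) (x y : ℝ) :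
    |min x a - min y a| + |max x b - max y b| + |clamp a b x - clamp a b y| = |x - y| := by
  wlog hxy : x ≤ y generalizing x y
  · have := this y x (le_of_not_ge hxy)
    rw [abs_sub_comm (min x a), abs_sub_comm (max x b), abs_sub_comm (clamp a b x),
      abs_sub_comm x]
    exact this
  have h1 : min x a ≤ min y a := min_le_min_right a hxy
  have h2 : max x b ≤ max y b := max_le_max_right b hxy
  have h3 : clamp a b x ≤ clamp a b y := max_le_max_left a (min_le_min_right b hxy)
  -- The three truncations are monotone and add up to `z` plus a constant, so their increments add
  -- up to that of `z`.
  have key : ∀ z, min z a + max z b + clamp a b z = z + a + b := by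
    intro z
    unfold clamp
    rcases le_total z a with h | h <;> rcases le_total z b with h' | h'
    · simp [h, h']; ring
    · obtain rfl : z = b := by linarith
      have : a = z := le_antisymm hab h
      simp [this]
    · simp [h, h']; ring
    · simp [h, h', hab]; ring
  rw [abs_sub_comm, abs_of_nonneg (sub_nonneg.2 h1), abs_sub_comm (max x b),
    abs_of_nonneg (sub_nonneg.2 h2), abs_sub_comm (clamp a b x), abs_of_nonneg (sub_nonneg.2 h3),
    abs_sub_comm x, abs_of_nonneg (sub_nonneg.2 hxy)]
  linarith [key x, key y]

open Classical in
/-- The part of an edge to the left of `a`; a vertical edge on the right is contracted. -/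
noncomputable def leftPart (a : ℝ) (e : Pt × Pt) : Pt × Pt :=
  if e.1.1 = e.2.1 ∧ a ≤ e.1.1 then ((a, e.1.2), (a, e.1.2))
  else ((min e.1.1 a, e.1.2), (min e.2.1 a, e.2.2))

open Classical in
/-- The part of an edge to the right of `b`; a vertical edge on the left is contracted. -/
noncomputable def rightPart (b : ℝ) (e : Pt × Pt) : Pt × Pt :=
  if e.1.1 = e.2.1 ∧ e.1.1 ≤ b then ((b, e.1.2), (b, e.1.2))
  else ((max e.1.1 b, e.1.2), (max e.2.1 b, e.2.2))

/-- A horizontal edge is split exactly into its three parts. A vertical edge survives on at most one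
side, since `a < b`; this is why the parts contract vertical edges instead of merely projecting
them. -/
theorem parts_le {a b : ℝ} (hab : a < b) (e : Pt × Pt) (he : e.1.1 = e.2.1 ∨ e.1.2 = e.2.2) :
    edgeLength s((leftPart a e).1, (leftPart a e).2) +
      edgeLength s((rightPart b e).1, (rightPart b e).2) + windowLength a b s(e.1, e.2) ≤
      edgeLength s(e.1, e.2) := by
  obtain ⟨⟨x, y⟩, x', y'⟩ := e
  simp only at he
  have hw := abs_sub_eq_window hab.le x x'
  have := abs_nonneg (y - y')
  by_cases hx : x = x'
  · subst hx
    rcases le_or_gt a x with h1 | h1 <;> rcases le_or_gt x b with h2 | h2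
    · simp [leftPart, rightPart, h1, h2]
    · simp [leftPart, rightPart, h1, not_le.2 h2]
    · simp [leftPart, rightPart, not_le.2 h1, h2]
    · exact absurd (h1.trans hab) (not_lt.2 h2.le)
  · have hy : y = y' := he.resolve_left hx
    subst hy
    simp only [leftPart, rightPart, hx, false_and, if_false, edgeLength_mk, windowLength_mk,
      sub_self, abs_zero, add_zero]
    exact hw.le

/-- Compare `T` with the figure made of its left and right parts, the two vertical lines, a
connection between them, and one horizontal segment for each terminal of `W`. The vertical lines
span the whole height of the strip, so they replace every vertical edge contracted onto them. -/
theorem sum_windowLength_le {P : Set Pt} {T : RectTree} (hT : IsMRST P T) (hP : P.Nontrivial)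
    {δ : ℝ} (hδ : 0 ≤ δ) (hstrip : ∀ q ∈ T.graph.support, 0 ≤ q.2 ∧ q.2 ≤ δ) {a b : ℝ}
    (hab : a < b) (hb : ∃ p ∈ P, p.1 = b) (W : Finset Pt)
    (hW : ∀ p, p ∈ W ↔ p ∈ P ∧ a < p.1 ∧ p.1 < b) :
    ∑ e ∈ T.finite_edges.toFinset, windowLength a b e ≤ 2 * δ + (W.card + 1) * (b - a) := by
  classical
  set E := T.finite_edges.toFinset with hE
  have hout : ∀ e : Sym2 Pt, s((Quot.out e).1, (Quot.out e).2) = e := fun e => Quot.out_eq e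
  have hEadj : ∀ e ∈ E, T.graph.Adj (Quot.out e).1 (Quot.out e).2 := by
    intro e he
    rw [hE, Set.Finite.mem_toFinset] at he
    rw [← SimpleGraph.mem_edgeSet, hout]
    exact he
  set FL := E.toList.map fun e => leftPart a (Quot.out e) with hFL
  set FR := E.toList.map fun e => rightPart b (Quot.out e) with hFR
  set FX : List (Pt × Pt) := [((a, 0), (a, δ)), ((b, 0), (b, δ)), ((a, 0), (b, 0))] with hFX
  set FW := W.toList.map fun p : Pt => ((a, p.2), p) with hFW
  set F := FL ++ FR ++ FX ++ FW with hF
  set V := T.finite_support.toFinset with hV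
  have hVmem : ∀ q, q ∈ V ↔ q ∈ T.graph.support := fun q => by rw [hV, Set.Finite.mem_toFinset]
  set l : Pt → Pt := fun q => (min q.1 a, q.2) with hl
  set r : Pt → Pt := fun q => (max q.1 b, q.2) with hr
  set N := V.image l ∪ V.image r ∪ V ∪ {(a, 0), (b, 0)} with hN
  have hNl : ∀ q ∈ T.graph.support, l q ∈ N := fun q hq => by
    simp only [hN, Finset.mem_union]
    exact Or.inl (Or.inl (Or.inl (Finset.mem_image_of_mem _ ((hVmem q).2 hq))))
  have hNr : ∀ q ∈ T.graph.support, r q ∈ N := fun q hq => by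
    simp only [hN, Finset.mem_union]
    exact Or.inl (Or.inl (Or.inr (Finset.mem_image_of_mem _ ((hVmem q).2 hq))))
  have hNv : ∀ q ∈ T.graph.support, q ∈ N := fun q hq => by
    simp only [hN, Finset.mem_union]
    exact Or.inl (Or.inr ((hVmem q).2 hq))
  have hNa : ((a, 0) : Pt) ∈ N := by simp [hN]
  have hNb : ((b, 0) : Pt) ∈ N := by simp [hN]
  -- the vertical lines at `a` and at `b`
  have hva : ∀ y y', 0 ≤ y → y ≤ δ → 0 ≤ y' → y' ≤ δ → ((a, y) : Pt) ∈ N → ((a, y') : Pt) ∈ N →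
      Linked F N (a, y) (a, y') := by
    intro y y' h1 h2 h3 h4 h5 h6
    refine ⟨h5, h6, ((a, 0), (a, δ)), by simp [hF, hFX], ?_, ?_⟩ <;>
    · rw [mem_segment_vertical, Set.uIcc_of_le hδ]
      exact ⟨rfl, ⟨by assumption, by assumption⟩⟩
  have hvb : ∀ y y', 0 ≤ y → y ≤ δ → 0 ≤ y' → y' ≤ δ → ((b, y) : Pt) ∈ N → ((b, y') : Pt) ∈ N →
      Linked F N (b, y) (b, y') := by
    intro y y' h1 h2 h3 h4 h5 h6
    refine ⟨h5, h6, ((b, 0), (b, δ)), by simp [hF, hFX], ?_, ?_⟩ <;>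
    · rw [mem_segment_vertical, Set.uIcc_of_le hδ]
      exact ⟨rfl, ⟨by assumption, by assumption⟩⟩
  have hvab : Linked F N (b, 0) (a, 0) :=
    ⟨hNb, hNa, ((a, 0), (b, 0)), by simp [hF, hFX], right_mem_segment ℝ _ _,
      left_mem_segment ℝ _ _⟩
  have hsymm : ∀ q q', Linked F N q q' → Linked F N q' q :=
    fun q q' ⟨h1, h2, e, he, h3, h4⟩ => ⟨h2, h1, e, he, h4, h3⟩
  -- the images of the edges
  have hadjl : ∀ q q', T.graph.Adj q q' → Linked F N (l q) (l q') := by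
    intro q q' h
    have hq : q ∈ T.graph.support := ⟨q', h⟩
    have hq' : q' ∈ T.graph.support := ⟨q, h.symm⟩
    -- In this case `leftPart` has contracted the edge, and the vertical line at `a` links the two
    -- projections instead.
    by_cases hv : q.1 = q'.1 ∧ a ≤ q.1
    · have e1 : l q = (a, q.2) := by simp [hl, hv.2]
      have e2 : l q' = (a, q'.2) := by simp [hl, hv.1 ▸ hv.2]
      have m1 := hNl q hq
      have m2 := hNl q' hq'
      rw [e1] at m1 ⊢
      rw [e2] at m2 ⊢
      exact hva _ _ (hstrip q hq).1 (hstrip q hq).2 (hstrip q' hq').1 (hstrip q' hq').2 m1 m2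
    · have he : s(q, q') ∈ E := by rw [hE, Set.Finite.mem_toFinset]; exact h
      refine ⟨hNl q hq, hNl q' hq', leftPart a (Quot.out s(q, q')), ?_, ?_⟩
      · simp only [hF, hFL, List.mem_append, List.mem_map, Finset.mem_toList]
        exact Or.inl (Or.inl (Or.inl ⟨_, he, rfl⟩))
      · have ho := hout s(q, q')
        rcases Sym2.eq_iff.1 ho with ⟨h1, h2⟩ | ⟨h1, h2⟩
        · rw [leftPart, h1, h2, if_neg hv]
          exact ⟨left_mem_segment ℝ _ _, right_mem_segment ℝ _ _⟩
        · rw [leftPart, h1, h2, if_neg (fun hc : q'.1 = q.1 ∧ a ≤ q'.1 => hv ⟨hc.1.symm, hc.1 ▸ hc.2⟩)]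
          exact ⟨right_mem_segment ℝ _ _, left_mem_segment ℝ _ _⟩
  have hadjr : ∀ q q', T.graph.Adj q q' → Linked F N (r q) (r q') := by
    intro q q' h
    have hq : q ∈ T.graph.support := ⟨q', h⟩
    have hq' : q' ∈ T.graph.support := ⟨q, h.symm⟩
    by_cases hv : q.1 = q'.1 ∧ q.1 ≤ b
    · have e1 : r q = (b, q.2) := by simp [hr, hv.2]
      have e2 : r q' = (b, q'.2) := by simp [hr, hv.1 ▸ hv.2]
      have m1 := hNr q hq
      have m2 := hNr q' hq'
      rw [e1] at m1 ⊢
      rw [e2] at m2 ⊢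
      exact hvb _ _ (hstrip q hq).1 (hstrip q hq).2 (hstrip q' hq').1 (hstrip q' hq').2 m1 m2
    · have he : s(q, q') ∈ E := by rw [hE, Set.Finite.mem_toFinset]; exact h
      refine ⟨hNr q hq, hNr q' hq', rightPart b (Quot.out s(q, q')), ?_, ?_⟩
      · simp only [hF, hFR, List.mem_append, List.mem_map, Finset.mem_toList]
        exact Or.inl (Or.inl (Or.inr ⟨_, he, rfl⟩))
      · have ho := hout s(q, q')
        rcases Sym2.eq_iff.1 ho with ⟨h1, h2⟩ | ⟨h1, h2⟩
        · rw [rightPart, h1, h2, if_neg hv]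
          exact ⟨left_mem_segment ℝ _ _, right_mem_segment ℝ _ _⟩
        · rw [rightPart, h1, h2, if_neg (fun hc : q'.1 = q.1 ∧ q'.1 ≤ b => hv ⟨hc.1.symm, hc.1 ▸ hc.2⟩)]
          exact ⟨right_mem_segment ℝ _ _, left_mem_segment ℝ _ _⟩
  have hlift : ∀ g : Pt → Pt, (∀ q q', T.graph.Adj q q' → Linked F N (g q) (g q')) →
      ∀ q ∈ T.graph.support, ∀ q' ∈ T.graph.support,
        Relation.ReflTransGen (Linked F N) (g q) (g q') := by
    intro g hg q hq q' hq'
    have := T.connected q hq q' hq'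
    rw [SimpleGraph.reachable_iff_reflTransGen] at this
    exact this.lift g hg
  -- The terminal at `b` is projected onto both vertical lines, by `l` and by `r`; it therefore
  -- attaches the image of the whole tree under either map to the corresponding line.
  obtain ⟨o, hoP, hob⟩ := hb
  have hosupp := hT.1 hoP
  have hlo : l o = (a, o.2) := by simp [hl, hob, hab.le]
  have hro : r o = (b, o.2) := by simp [hr, hob]
  have hla : ∀ q ∈ T.graph.support, Relation.ReflTransGen (Linked F N) (l q) (a, 0) := by
    intro q hq
    refine (hlift l hadjl q hq o hosupp).tail ?_
    rw [hlo]
    exact hva _ _ (hstrip o hosupp).1 (hstrip o hosupp).2 le_rfl hδ (hlo ▸ hNl o hosupp) hNa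
  have hra : ∀ q ∈ T.graph.support, Relation.ReflTransGen (Linked F N) (r q) (a, 0) := by
    intro q hq
    refine ((hlift r hadjr q hq o hosupp).tail ?_).tail hvab
    rw [hro]
    exact hvb _ _ (hstrip o hosupp).1 (hstrip o hosupp).2 le_rfl hδ (hro ▸ hNr o hosupp) hNb
  have hconn : ∀ p ∈ P, Relation.ReflTransGen (Linked F N) p (a, 0) := by
    intro p hp
    have hps := hT.1 hp
    rcases le_or_gt p.1 a with h1 | h1
    · have : l p = p := by ext <;> simp [hl, h1]
      have h := hla p hps
      rwa [this] at h
    rcases le_or_gt b p.1 with h2 | h2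
    · have : r p = p := by ext <;> simp [hr, h2]
      have h := hra p hps
      rwa [this] at h
    · have : l p = (a, p.2) := by simp [hl, h1.le]
      have h := hla p hps
      rw [this] at h
      refine Relation.ReflTransGen.head ⟨hNv p hps, this ▸ hNl p hps, ((a, p.2), p), ?_,
        right_mem_segment ℝ _ _, left_mem_segment ℝ _ _⟩ h
      simp only [hF, hFW, List.mem_append, List.mem_map, Finset.mem_toList]
      exact Or.inr ⟨p, (hW p).2 ⟨hp, h1, h2⟩, rfl⟩
  have haxis : ∀ e ∈ F, e.1.1 = e.2.1 ∨ e.1.2 = e.2.2 := by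
    intro e he
    simp only [hF, List.mem_append] at he
    rcases he with ((he | he) | he) | he
    · obtain ⟨d, hd, rfl⟩ := List.mem_map.1 he
      have := T.axis_parallel _ _ (hEadj d (by simpa using hd))
      unfold leftPart
      split_ifs
      · exact Or.inl rfl
      · exact this.imp (fun h => by simp only [h]) id
    · obtain ⟨d, hd, rfl⟩ := List.mem_map.1 he
      have := T.axis_parallel _ _ (hEadj d (by simpa using hd))
      unfold rightPart
      split_ifs
      · exact Or.inl rfl
      · exact this.imp (fun h => by simp only [h]) id
    · simp only [hFX, List.mem_cons, List.not_mem_nil, or_false] at he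
      rcases he with rfl | rfl | rfl <;> simp
    · obtain ⟨d, hd, rfl⟩ := List.mem_map.1 he
      exact Or.inr rfl
  obtain ⟨T', hT', hlen⟩ := exists_steinerTree_of_linked P hP F haxis N (a, 0) hconn
  have hmin := (hT.2 T' hT').trans hlen
  have hsumL : (FL.map fun e => edgeLength s(e.1, e.2)).sum =
      ∑ e ∈ E, edgeLength s((leftPart a (Quot.out e)).1, (leftPart a (Quot.out e)).2) := by
    rw [hFL, List.map_map, ← Finset.sum_map_toList]; rfl
  have hsumR : (FR.map fun e => edgeLength s(e.1, e.2)).sum =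
      ∑ e ∈ E, edgeLength s((rightPart b (Quot.out e)).1, (rightPart b (Quot.out e)).2) := by
    rw [hFR, List.map_map, ← Finset.sum_map_toList]; rfl
  have hsumX : (FX.map fun e => edgeLength s(e.1, e.2)).sum = 2 * δ + (b - a) := by
    simp only [hFX, List.map_cons, List.map_nil, List.sum_cons, List.sum_nil, edgeLength_mk,
      sub_self, abs_zero, zero_sub, abs_neg, abs_of_nonneg hδ, abs_sub_comm a b,
      abs_of_pos (sub_pos.2 hab)]
    ring
  have hsumW : (FW.map fun e => edgeLength s(e.1, e.2)).sum ≤ W.card * (b - a) := by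
    rw [hFW, List.map_map, ← nsmul_eq_mul]
    have : (W.toList.map ((fun e : Pt × Pt => edgeLength s(e.1, e.2)) ∘
        fun p : Pt => ((a, p.2), p))).sum = ∑ p ∈ W, edgeLength s((a, p.2), p) := by
      rw [← Finset.sum_map_toList]; rfl
    rw [this]
    refine Finset.sum_le_card_nsmul _ _ _ fun p hp => ?_
    have := (hW p).1 hp
    simp only [edgeLength_mk, sub_self, abs_zero, add_zero]
    rw [abs_sub_comm, abs_of_pos (by linarith)]
    linarith
  have hparts : ∑ e ∈ E, (edgeLength s((leftPart a (Quot.out e)).1, (leftPart a (Quot.out e)).2) +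
      edgeLength s((rightPart b (Quot.out e)).1, (rightPart b (Quot.out e)).2) +
      windowLength a b e) ≤ T.length := by
    refine Finset.sum_le_sum fun e he => ?_
    have := parts_le hab (Quot.out e) (T.axis_parallel _ _ (hEadj e he))
    rwa [hout] at this
  rw [Finset.sum_add_distrib, Finset.sum_add_distrib, ← hsumL, ← hsumR] at hparts
  rw [hF, List.map_append, List.map_append, List.map_append, List.sum_append, List.sum_append,
    List.sum_append, hsumX] at hmin
  linarith

/-! ### The bound on the number of crossings -/

-- Integrate the number of cut edges over the strip and exchange sum and integral: each horizontal
-- edge contributes the length of its intersection with the strip.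
open MeasureTheory in
theorem mul_le_sum_windowLength (T : RectTree) {a b m : ℝ} (hab : a ≤ b)
    (hm : ∀ x, a ≤ x → x < b → m ≤ (T.cut x).ncard) :
    m * (b - a) ≤ ∑ e ∈ T.finite_edges.toFinset, windowLength a b e := by
  classical
  set A := T.finite_adj.toFinset.filter fun e => e.1.1 < e.2.1 with hA
  have hAmem : ∀ e, e ∈ A ↔ T.graph.Adj e.1 e.2 ∧ e.1.1 < e.2.1 := by
    intro e
    simp [hA]
  have hcut : ∀ x, ((T.cut x).ncard : ℝ) =
      ∑ e ∈ A, (Set.Ico e.1.1 e.2.1).indicator (fun _ => (1 : ℝ)) x := by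
    intro x
    have : T.cut x = (A.filter fun e => x ∈ Set.Ico e.1.1 e.2.1 : Finset (Pt × Pt)) := by
      ext e
      simp only [RectTree.cut, Finset.coe_filter, hAmem, Set.mem_ofPred_eq, Set.mem_Ico]
      exact ⟨fun h => ⟨⟨h.1, h.2.1.trans_lt h.2.2⟩, h.2⟩, fun h => ⟨h.1.1, h.2⟩⟩
    rw [this, Set.ncard_coe_finset, Finset.card_filter, Nat.cast_sum]
    refine Finset.sum_congr rfl fun e _ => ?_
    simp [Set.indicator_apply]
  have hint : ∀ e ∈ A, IntegrableOn ((Set.Ico e.1.1 e.2.1).indicator fun _ => (1 : ℝ))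
      (Set.Ico a b) := by
    intro e _
    refine Integrable.indicator ?_ measurableSet_Ico
    exact integrableOn_const (by simp)
  have h1 : m * (b - a) ≤
      ∫ x in Set.Ico a b, ∑ e ∈ A, (Set.Ico e.1.1 e.2.1).indicator (fun _ => (1 : ℝ)) x := by
    have : m * (b - a) = ∫ _ in Set.Ico a b, m := by
      rw [setIntegral_const, Real.volume_real_Ico_of_le hab, smul_eq_mul, mul_comm]
    rw [this]
    refine setIntegral_mono_on (integrableOn_const (by simp))
      (integrable_finsetSum _ hint) measurableSet_Ico fun x hx => ?_
    rw [← hcut]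
    exact hm x hx.1 hx.2
  rw [integral_finsetSum _ hint] at h1
  have h2 : ∀ e ∈ A, ∫ x in Set.Ico a b, (Set.Ico e.1.1 e.2.1).indicator (fun _ => (1 : ℝ)) x ≤
      windowLength a b s(e.1, e.2) := by
    intro e he
    rw [setIntegral_indicator measurableSet_Ico, setIntegral_const, Set.Ico_inter_Ico,
      Real.volume_real_Ico, smul_eq_mul, mul_one, windowLength_mk]
    refine max_le ?_ (abs_nonneg _)
    rw [abs_sub_comm]
    refine le_trans ?_ (le_abs_self _)
    have hlt := ((hAmem e).1 he).2
    unfold clamp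
    have k1 : b ⊓ e.2.1 ≤ max a (min e.2.1 b) := by
      rw [inf_comm]; exact le_max_right _ _
    have k2 : max a (min e.1.1 b) ≤ a ⊔ e.1.1 := max_le_max_left a (min_le_left _ _)
    linarith
  refine h1.trans ((Finset.sum_le_sum h2).trans ?_)
  have hinj : Set.InjOn (fun e : Pt × Pt => s(e.1, e.2)) (A : Set (Pt × Pt)) := by
    intro e he e' he' h
    have k1 := ((hAmem e).1 he).2
    have k2 := ((hAmem e').1 he').2
    rcases Sym2.eq_iff.1 h with ⟨h1, h2⟩ | ⟨h1, h2⟩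
    · exact Prod.ext h1 h2
    · rw [h1, h2] at k1
      exact absurd k1 (not_lt.2 k2.le)
  rw [← Finset.sum_image (f := windowLength a b) hinj]
  refine Finset.sum_le_sum_of_subset_of_nonneg ?_ fun e _ _ => windowLength_nonneg a b e
  intro e he
  obtain ⟨d, hd, rfl⟩ := Finset.mem_image.1 he
  rw [Set.Finite.mem_toFinset]
  exact ((hAmem d).1 hd).1

/-- The number of horizontal edges of a Hwang tree over the left end of a strip that contains the
terminals `W` in its interior and has a terminal on its right side. -/
theorem ncard_cut_mul_le {P : Set Pt} {T : RectTree} (hT : IsHwangTree P T) (hP : P.Nontrivial)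
    (hfin : P.Finite) {δ : ℝ} (hδ : 0 ≤ δ) (hstrip : ∀ p ∈ P, 0 ≤ p.2 ∧ p.2 ≤ δ) {a b : ℝ}
    (hab : a < b) (hb : ∃ p ∈ P, p.1 = b) (W : Finset Pt)
    (hW : ∀ p, p ∈ W ↔ p ∈ P ∧ a < p.1 ∧ p.1 < b) :
    (T.cut a).ncard * (b - a) ≤ 2 * δ + (4 * W.card + 1) * (b - a) := by
  have hl := hT.isLocallyAlternating
  have hnode : ∀ q ∈ T.graph.support, 0 ≤ q.2 ∧ q.2 ≤ δ := by
    rintro q ⟨q', h⟩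
    obtain ⟨-, p, hp, hpq⟩ := hl.aligned q q' h
    rw [← hpq]
    exact hstrip p hp
  have h1 := sum_windowLength_le hT.1 hP hδ hnode hab hb W hW
  -- Over the half-open strip at most `W.card` terminals have been passed, each costing three edges.
  -- The further `W.card` in the result comes from the replacement tree.
  have h2 := mul_le_sum_windowLength T (m := (T.cut a).ncard - 3 * W.card) hab.le (by
    intro x hax hxb
    have h := ncard_cut_le hl hax hfin
    have hsub : {p | p ∈ P ∧ a < p.1 ∧ p.1 ≤ x} ⊆ (W : Set Pt) := fun p hp =>
      (hW p).2 ⟨hp.1, hp.2.1, hp.2.2.trans_lt hxb⟩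
    have hcard := Set.ncard_le_ncard hsub W.finite_toSet
    rw [Set.ncard_coe_finset] at hcard
    have : ((T.cut a).ncard : ℝ) ≤ (T.cut x).ncard + 3 * W.card := by
      exact_mod_cast h.trans (by omega)
    linarith)
  linarith

end Rectilinear

/-! ### The bound at a gap between consecutive terminals -/

theorem mainTheorem3 (δ : ℝ) (hδ : 0 ≤ δ) (n : ℕ) (p : Fin n → Rectilinear.Pt)
    (hinj : Function.Injective p)
    (hstrip : ∀ l, 0 ≤ (p l).2 ∧ (p l).2 ≤ δ)
    (hsorted : Monotone fun l => (p l).1)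
    (T : Rectilinear.RectTree) (hT : Rectilinear.IsHwangTree (Set.range p) T)
    (c₁ : ℕ) (c₂ : ℝ) (hc₂ : 0 < c₂)
    (i i' j : Fin n) (hi' : (i' : ℕ) = (i : ℕ) + 1)
    (hj : (j : ℕ) = (i : ℕ) + ⌈Real.sqrt δ⌉₊ + c₁)
    (hsep : (p i).1 < (p i').1)
    (hgap : c₂ * Real.sqrt δ < (p j).1 - (p i).1) :
    (T.crossings (((p i).1 + (p i').1) / 2)).Finite ∧
      ((T.crossings (((p i).1 + (p i').1) / 2)).ncard : ℝ) ≤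
        17 * (c₁ : ℝ) + 36 + (4 / c₂ + 17) * Real.sqrt δ := by
  classical
  have hsq := Real.sqrt_nonneg δ
  set s := ((p i).1 + (p i').1) / 2 with hs
  have hij : i < j := by
    by_contra h
    have : (p j).1 ≤ (p i).1 := hsorted (not_lt.1 h)
    have : 0 ≤ c₂ * √δ := by positivity
    linarith
  have hi'j : (p i').1 ≤ (p j).1 := hsorted (by
    rw [Fin.le_def, hi']
    exact hij)
  have hright : ∀ l, s < (p l).1 → i < l := by
    intro l hl
    by_contra h
    have : (p l).1 ≤ (p i).1 := hsorted (not_lt.1 h)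
    linarith
  have hleft : ∀ l, i < l → s < (p l).1 := by
    intro l hl
    have : (p i').1 ≤ (p l).1 := hsorted (by
      rw [Fin.le_def, hi']
      exact hl)
    linarith
  have hne : ∀ q ∈ Set.range p, q.1 ≠ s := by
    rintro _ ⟨l, rfl⟩ h
    rcases lt_or_ge i l with hl | hl
    · exact (hleft l hl).ne' h
    · have : (p l).1 ≤ (p i).1 := hsorted hl
      linarith
  have hsub := Rectilinear.crossings_subset hT.isLocallyAlternating hne
  have hcfin := (T.finite_cut s).image fun e : Rectilinear.Pt × Rectilinear.Pt => (s, e.1.2)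
  refine ⟨hcfin.subset hsub, ?_⟩
  have hcard : ((T.crossings s).ncard : ℝ) ≤ (T.cut s).ncard := by
    exact_mod_cast (Set.ncard_le_ncard hsub hcfin).trans (Set.ncard_image_le (T.finite_cut s))
  refine hcard.trans ?_
  set W := (Finset.univ.image p).filter fun q => s < q.1 ∧ q.1 < (p j).1 with hW
  have hsj : s < (p j).1 := hleft j hij
  have key := Rectilinear.ncard_cut_mul_le hT
    ⟨p i, ⟨i, rfl⟩, p j, ⟨j, rfl⟩, fun h => hij.ne (hinj h)⟩ (Set.finite_range p) hδ
    (by rintro _ ⟨l, rfl⟩; exact hstrip l) hsj ⟨p j, ⟨j, rfl⟩, rfl⟩ W (by simp [hW])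
  -- Only indices strictly between `i` and `j` contribute, which saves one and absorbs the rounding
  -- up of `√δ`.
  have hWcard : W.card + 1 ≤ ⌈√δ⌉₊ + c₁ := by
    have : W ⊆ (Finset.Ioo i j).image p := by
      intro q hq
      simp only [hW, Finset.mem_filter, Finset.mem_image, Finset.mem_univ, true_and] at hq
      obtain ⟨⟨l, rfl⟩, h1, h2⟩ := hq
      refine Finset.mem_image_of_mem _ (Finset.mem_Ioo.2 ⟨hright l h1, ?_⟩)
      by_contra h
      have : (p j).1 ≤ (p l).1 := hsorted (not_lt.1 h)
      linarith
    have h1 := (Finset.card_le_card this).trans Finset.card_image_le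
    rw [Fin.card_Ioo] at h1
    have : (i : ℕ) < j := hij
    omega
  have hK : (W.card : ℝ) + 1 ≤ √δ + 1 + c₁ := by
    have h1 : ((W.card + 1 : ℕ) : ℝ) ≤ ((⌈√δ⌉₊ + c₁ : ℕ) : ℝ) := by exact_mod_cast hWcard
    push_cast at h1
    linarith [Nat.ceil_lt_add_one hsq]
  -- As `s` is the midpoint of `(p i).1` and `(p i').1`, and `(p i').1 ≤ (p j).1`, at least half of
  -- the gap lies to the right of `s`.
  have hlen : c₂ * √δ / 2 ≤ (p j).1 - s := by linarith
  have hδ2 : 2 * δ ≤ 4 / c₂ * √δ * ((p j).1 - s) := by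
    have h1 : 4 / c₂ * √δ * (c₂ * √δ / 2) ≤ 4 / c₂ * √δ * ((p j).1 - s) :=
      mul_le_mul_of_nonneg_left hlen (by positivity)
    have h2 : 4 / c₂ * √δ * (c₂ * √δ / 2) = 2 * (√δ * √δ) := by field_simp; ring
    rw [h2, Real.mul_self_sqrt hδ] at h1
    exact h1
  have hpos : 0 < (p j).1 - s := sub_pos.2 hsj
  have hfin : ((T.cut s).ncard : ℝ) ≤ 4 / c₂ * √δ + (4 * W.card + 1) := by
    refine le_of_mul_le_mul_right ?_ hpos
    linarith
  have : (0 : ℝ) ≤ c₁ := Nat.cast_nonneg c₁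
  -- What has been shown is the stronger bound `4 c₁ + 1 + (4 / c₂ + 4) √δ`.
  linarith
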